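/- Let $n\ge 3$ and $Q=(0,0,1)\in\mathbb S^2$. Fix an even $\varphi_0\in C_c^\infty((-2,2);[0,1])$ with $\varphi_0=1$ on $[-1,1]$, and put $\varphi_k(r)=\varphi_0(2^{-k}r)-\varphi_0(2^{1-k}r)$ for $k\ge1$, $\Delta_kf=\mathcal F^{-1}(\varphi_k(|\xi|)\hat f)$ for $k\ge0$, where $\hat f(\xi)=\int_{\mathbb R^n} e^{-i\xi\cdot x}f(x)\,dx$. For $\sigma>0$ let $B^\sigma_{2,1}$ be the inhomogeneous Besov space of $f\in L^2(\mathbb R^n;\mathbb C)$ with $$\|f\|_{B^\sigma_{2,1}}=\sum_{k\ge0}2^{\sigma k}\|\Delta_kf\|_{L^2}<\infty .$$ Let $B^\sigma_Q$ be the set of $u:\mathbb R^n\to\mathbb S^2$ with $u_l-Q_l\in B^\sigma_{2,1}$ for $l=1,2,3$, and put $$d^\sigma_Q(u,v)=\sum_{l=1}^3\|u_l-v_l\|_{B^\sigma_{2,1}},\qquad \|u\|_{B^\sigma_Q}=d^\sigma_Q(u,Q).$$ Let $$L(v)=\frac{v_1+iv_2}{1+v_3}\quad(v\in\mathbb S^2,\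 v\neq -Q),\qquad L^{-1}(z)=\frac{1}{1+|z|^2}\bigl(2z_1,\,2z_2,\,1-|z|^2\bigr)\quad(z=z_1+iz_2\in\mathbb C)$$ be the stereographic projection and its inverse. **Lemma 2.2.** There are finite functions $C_1(\sigma,a,b)\ge 0$ and $C_2(\sigma,a,b)\ge 0$, nondecreasing in $a$ and in $b$ and depending otherwise only on $n$ (and on the fixed $\varphi_0$), such that for every $\sigma_0\ge\frac{n+1}{2}$ there are $\varepsilon_0>0$ and $C\ge 0$, depending only on $n$, $\sigma_0$ (and $\varphi_0$), for which the following holds. 1. If $f,g:\mathbb R^n\to\mathbb C$ satisfy $\|f\|_{B^{\sigma_0}_{2,1}},\|g\|_{B^{\sigma_0}_{2,1}}\le\varepsilon_0$, then for every $\sigma\ge\sigma_0$ with $f,g\in B^\sigma_{2,1}$ we have $L^{-1}(f),L^{-1}(g)\in B^\sigma_Q$ and $$d^\sigma_Q(L^{-1}(f),L^{-1}(g))\le C_1\bigl(\sigma,\|f\|_{B^\sigma_{2,1}},\|g\|_{B^\sigma_{2,1}}\bigr)\,\|f-g\|_{B^\sigma_{2,1}}.$$ 2. If $u,v:\mathbb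 R^n\to\mathbb S^2$ satisfy $\|u\|_{B^{\sigma_0}_Q},\|v\|_{B^{\sigma_0}_Q}\le\varepsilon_0$, then for every $\sigma\ge\sigma_0$ with $u,v\in B^\sigma_Q$ we have $L(u),L(v)\in B^\sigma_{2,1}$ and $$\|L(u)-L(v)\|_{B^\sigma_{2,1}}\le C_2\bigl(\sigma,\|u\|_{B^\sigma_Q},\|v\|_{B^\sigma_Q}\bigr)\,d^\sigma_Q(u,v).$$ 3. If $0<\varepsilon\le\varepsilon_0$ and $\|f\|_{B^{\sigma_0}_{2,1}}\le\varepsilon$, then $\|L^{-1}(f)\|_{B^{\sigma_0}_Q}\le C\varepsilon$. 4. If $0<\varepsilon\le\varepsilon_0$ and $\|u\|_{B^{\sigma_0}_Q}\le\varepsilon$, then $\|L(u)\|_{B^{\sigma_0}_{2,1}}\le C\varepsilon$. -/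

import Mathlib

open MeasureTheory
open scoped ENNReal NNReal FourierTransform

/-- A Littlewood-Paley bump function: a smooth even function `φ₀ : ℝ → [0, 1]`, compactly
supported in `(-2, 2)` and equal to `1` on `[-1, 1]`. -/
structure LPCutoff where
  toFun : ℝ → ℝ
  smooth : ContDiff ℝ (⊤ : ℕ∞) toFun
  range_subset : ∀ r, toFun r ∈ Set.Icc (0 : ℝ) 1
  even : ∀ r, toFun (-r) = toFun r
  eq_one : ∀ r ∈ Set.Icc (-1 : ℝ) 1, toFun r = 1
  compact_support : HasCompactSupport toFun
  tsupport_subset : tsupport toFun ⊆ Set.Ioo (-2 : ℝ) 2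

/-- Littlewood-Paley bump functions exist. -/
instance : Nonempty LPCutoff := by
  let b : ContDiffBump (0 : ℝ) := ⟨1, 3 / 2, by norm_num, by norm_num⟩
  refine ⟨⟨b, b.contDiff, fun r => ⟨b.nonneg, b.le_one⟩, fun r => b.neg r, fun r hr => ?_,
    b.hasCompactSupport, ?_⟩⟩
  · apply b.one_of_mem_closedBall
    rw [Real.closedBall_eq_Icc]
    simpa [b] using hr
  · rw [b.tsupport_eq, Real.closedBall_eq_Icc]
    intro r hr
    have h : -(3 / 2) ≤ r ∧ r ≤ 3 / 2 := by simpa [b] using hr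
    exact ⟨by linarith [h.1], by linarith [h.2]⟩

/-- The inhomogeneous dyadic partition of unity on `[0, ∞)`: `φ₀` for `k = 0`, and
`φ (r / 2 ^ k)` with `φ r = φ₀ r - φ₀ (2 r)` for `k ≥ 1`. -/
noncomputable def LPCutoff.dyadic (φ : LPCutoff) : ℕ → ℝ → ℝ
  | 0, r => φ.toFun r
  | k + 1, r => φ.toFun (r / 2 ^ (k + 1)) - φ.toFun (2 * (r / 2 ^ (k + 1)))

theorem LPCutoff.continuous_dyadic (φ : LPCutoff) (k : ℕ) : Continuous (φ.dyadic k) := by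
  have h := φ.smooth.continuous
  cases k with
  | zero => exact h
  | succ k => unfold LPCutoff.dyadic; fun_prop

theorem LPCutoff.abs_dyadic_le (φ : LPCutoff) (k : ℕ) (r : ℝ) : |φ.dyadic k r| ≤ 1 := by
  cases k with
  | zero =>
    have h := φ.range_subset r
    exact abs_le.2 ⟨by simp only [LPCutoff.dyadic]; linarith [h.1], h.2⟩
  | succ k =>
    have h := φ.range_subset (r / 2 ^ (k + 1))
    have h' := φ.range_subset (2 * (r / 2 ^ (k + 1)))
    simp only [LPCutoff.dyadic]
    exact abs_le.2 ⟨by linarith [h.1, h'.2], by linarith [h.2, h'.1]⟩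

theorem LPCutoff.memLp_dyadic_mul {n : ℕ} (φ : LPCutoff) (k : ℕ)
    (F : Lp ℂ 2 (volume : Measure (EuclideanSpace ℝ (Fin n)))) :
    MemLp (fun ξ => (φ.dyadic k (2 * Real.pi * ‖ξ‖) : ℂ) * F ξ) 2
      (volume : Measure (EuclideanSpace ℝ (Fin n))) := by
  have hc : Continuous fun ξ : EuclideanSpace ℝ (Fin n) =>
      (φ.dyadic k (2 * Real.pi * ‖ξ‖) : ℂ) := by
    have h := φ.continuous_dyadic k
    fun_prop
  refine (Lp.memLp F).of_le (hc.aestronglyMeasurable.mul (Lp.memLp F).1)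
    (Filter.Eventually.of_forall fun ξ => ?_)
  rw [norm_mul, Complex.norm_real, Real.norm_eq_abs]
  exact mul_le_of_le_one_left (norm_nonneg _) (φ.abs_dyadic_le k _)

/-- The frequency projection `Δ_k f = 𝓕⁻¹ (φ_k 𝓕 f)` on `L²(ℝⁿ; ℂ)`. Mathlib's Fourier transform
has the kernel `exp (-2 π i ⟨x, ξ⟩)`; the factor `2 π` turns its frequency variable into the one of
the kernel `exp (-i ⟨x, ξ⟩)`. -/
noncomputable def LPCutoff.proj {n : ℕ} (φ : LPCutoff) (k : ℕ)
    (f : Lp ℂ 2 (volume : Measure (EuclideanSpace ℝ (Fin n)))) :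
    Lp ℂ 2 (volume : Measure (EuclideanSpace ℝ (Fin n))) :=
  𝓕⁻ ((φ.memLp_dyadic_mul k (𝓕 f)).toLp _)

open Classical in
/-- The norm `∑ₖ 2 ^ (σ k) ‖Δ_k f‖_{L²}` of the inhomogeneous Besov space `B^σ_{2,1}(ℝⁿ; ℂ)`, with
value `∞` exactly when `f` is not in the space. It is meant for `σ ≥ 0`, where the space is
contained in `L²`. -/
noncomputable def besovNorm {n : ℕ} (φ : LPCutoff) (σ : ℝ)
    (f : EuclideanSpace ℝ (Fin n) → ℂ) : ℝ≥0∞ :=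
  if h : MemLp f 2 volume then
    ∑' k : ℕ, ENNReal.ofReal ((2 : ℝ) ^ (σ * (k : ℝ))) * ‖φ.proj k (h.toLp f)‖ₑ
  else ∞

/-- `f ∈ B^σ_{2,1}(ℝⁿ; ℂ)`. -/
def MemBesov {n : ℕ} (φ : LPCutoff) (σ : ℝ) (f : EuclideanSpace ℝ (Fin n) → ℂ) : Prop :=
  besovNorm φ σ f < ∞

/-- The unit sphere `𝕊²` of `ℝ³`. -/
abbrev Sphere2 : Type := Metric.sphere (0 : EuclideanSpace ℝ (Fin 3)) 1

/-- The coordinates `v₁, v₂, v₃` of a point of `𝕊²`, indexed by `0, 1, 2`. -/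
def Sphere2.coord (v : Sphere2) (l : Fin 3) : ℝ := (v : EuclideanSpace ℝ (Fin 3)) l

/-- The point `Q = (0, 0, 1)`. -/
noncomputable def poleQ : Sphere2 :=
  ⟨!₂[0, 0, 1], by simp [EuclideanSpace.norm_eq, Fin.sum_univ_three]⟩

/-- The distance `d^σ_Q(u, v) = ∑ₗ ‖uₗ - vₗ‖_{B^σ_{2,1}}` of two maps into `𝕊²`. -/
noncomputable def besovDist {n : ℕ} (φ : LPCutoff) (σ : ℝ)
    (u v : EuclideanSpace ℝ (Fin n) → Sphere2) : ℝ≥0∞ :=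
  ∑ l : Fin 3, besovNorm φ σ fun x => (((u x).coord l - (v x).coord l : ℝ) : ℂ)

/-- The quantity `‖u‖_{B^σ_Q} = d^σ_Q(u, Q)`. -/
noncomputable def besovQNorm {n : ℕ} (φ : LPCutoff) (σ : ℝ)
    (u : EuclideanSpace ℝ (Fin n) → Sphere2) : ℝ≥0∞ :=
  besovDist φ σ u fun _ => poleQ

/-- `u ∈ B^σ_Q`: all components `uₗ - Qₗ` belong to `B^σ_{2,1}`. -/
def MemBesovQ {n : ℕ} (φ : LPCutoff) (σ : ℝ) (u : EuclideanSpace ℝ (Fin n) → Sphere2) : Prop :=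
  ∀ l : Fin 3, MemBesov φ σ fun x => (((u x).coord l - poleQ.coord l : ℝ) : ℂ)

/-- The stereographic projection `L v = (v₁ + i v₂) / (1 + v₃)`; its value at the point
`(0, 0, -1)`, where the projection is not defined, is `0`. -/
noncomputable def stereoL (v : Sphere2) : ℂ :=
  ((v.coord 0 : ℂ) + Complex.I * (v.coord 1 : ℂ)) / (1 + (v.coord 2 : ℂ))

/-- The inverse stereographic projection
`L⁻¹ z = (2 z₁, 2 z₂, 1 - |z|²) / (1 + |z|²)` for `z = z₁ + i z₂`. -/
noncomputable def stereoLInv (z : ℂ) : Sphere2 :=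
  ⟨!₂[2 * z.re / (1 + ‖z‖ ^ 2), 2 * z.im / (1 + ‖z‖ ^ 2), (1 - ‖z‖ ^ 2) / (1 + ‖z‖ ^ 2)], by
    have h : (1 + ‖z‖ ^ 2) ≠ 0 := by positivity
    have hz : ‖z‖ ^ 2 = z.re ^ 2 + z.im ^ 2 := by
      rw [Complex.sq_norm, Complex.normSq_apply]; ring
    rw [mem_sphere_zero_iff_norm, EuclideanSpace.norm_eq, Real.sqrt_eq_one]
    simp only [Fin.sum_univ_three, Real.norm_eq_abs, sq_abs, Matrix.cons_val]
    field_simp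
    rw [hz]
    ring⟩

/-! In coordinates centred at `Q` and at `0`, both `L` and its inverse are quotients `z / (1 + h)`,
with `z` and `h` polynomial in the data and their conjugates and `h` small. So the theorem reduces
to two facts about `B^σ_{2,1}`: it is an algebra for `σ ≥ n / 2`, and `h ↦ -h / (1 + h)` is bounded
on it, with a smallness condition on `h` that does not depend on `σ`.

Both facts come from one inequality that replaces paraproducts. Let `tail R f` be the `L²` norm of
the frequencies of `f` of size at least `R`. Cutting `f` at `a` and `g` at `b`, the product of the
low parts has no frequencies beyond `a + b`, whence `tail (a + b) (f g) ≤ ‖𝓕 f‖₁ tail b g + ‖g‖_∞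
tail a f` (`tail_mul_le`). The Besov norm is equivalent to `‖f‖₂ + ∫ R^(σ-1) tail R f dR`
(`tailIntegral_le_besov`, `besov_le_tailIntegral`) and dominates `‖𝓕 f‖₁` (`wiener_le_besov`), so
integrating with `a = θ R`, `b = (1 - θ) R` gives the algebra property.

For the inverse, `u = -h / (1 + h)` solves `u = -(h + h u)`. If `‖𝓕 h‖₁ ≤ 1/2` and `1 - θ` is close
enough to `1`, the term containing `u` has a coefficient below `1` and is absorbed
(`tailIntegral_inverse_le`). How close depends on `σ`, but the threshold `1/2` does not; this is why
one `ε₀` serves every `σ`. -/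

namespace FourierL2

/-! ### The Fourier transform on `L²`: inversion, conjugation, agreement with the integral on `L¹`.
-/

variable {V : Type*} [NormedAddCommGroup V] [InnerProductSpace ℝ V] [FiniteDimensional ℝ V]
  [MeasurableSpace V] [BorelSpace V]

open scoped ComplexConjugate SchwartzMap

theorem locallyIntegrable (f : Lp ℂ 2 (volume : Measure V)) : LocallyIntegrable f volume :=
  (Lp.memLp f).locallyIntegrable (by norm_num)

/-- Two locally integrable functions with the same integrals against Schwartz functions agree. -/
theorem ae_eq_of_integral_schwartz {f g : V → ℂ} (hf : LocallyIntegrable f volume)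
    (hg : LocallyIntegrable g volume)
    (h : ∀ s : 𝓢(V, ℂ), (∀ x, conj (s x) = s x) → ∫ x, s x * f x = ∫ x, s x * g x) :
    f =ᵐ[volume] g := by
  refine ae_eq_of_integral_contDiff_smul_eq hf hg fun s hs hc => ?_
  have hc' : HasCompactSupport fun x => (s x : ℂ) :=
    hc.comp_left (g := fun r : ℝ => (r : ℂ)) (by simp)
  have := h (hc'.toSchwartzMap (Complex.ofRealCLM.contDiff.comp hs))
    (fun x => Complex.conj_ofReal (s x))
  simp only [Complex.real_smul]
  exact this

/-- The `L²` transform is compatible with that of tempered distributions, which is defined by this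
duality. Testing against Schwartz functions is what links it to the Fourier integral. -/
theorem integral_fourier_mul (f : Lp ℂ 2 (volume : Measure V)) (s : 𝓢(V, ℂ)) :
    ∫ x, 𝓕 s x * f x = ∫ x, s x * (𝓕 f : Lp ℂ 2 (volume : Measure V)) x := by
  have h := congrArg (fun T => T s) (Lp.fourier_toTemperedDistribution_eq f)
  simpa [TemperedDistribution.fourier_apply] using h

theorem integral_fourier_mul_of_integrable {H : V → ℂ} (hH : Integrable H) (s : 𝓢(V, ℂ)) :
    ∫ x, 𝓕 s x * H x = ∫ x, s x * 𝓕 H x := by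
  have := VectorFourier.integral_fourierIntegral_smul_eq_flip (L := innerₗ V)
    Real.continuous_fourierChar continuous_inner (s.integrable (μ := volume)) hH
  rw [flip_innerₗ] at this
  simpa [SchwartzMap.fourier_coe] using! this

theorem integral_fourierInv_mul_of_integrable {H : V → ℂ} (hH : Integrable H) (s : 𝓢(V, ℂ)) :
    ∫ x, 𝓕⁻ s x * H x = ∫ x, s x * 𝓕⁻ H x := by
  have h := integral_fourier_mul_of_integrable hH.comp_neg s
  have h1 : ∫ x, 𝓕⁻ s x * H x = ∫ x, 𝓕 s x * H (-x) := by
    rw [← integral_neg_eq_self]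
    simp [SchwartzMap.fourierInv_coe, SchwartzMap.fourier_coe, Real.fourierInv_eq_fourier_neg]
  rw [h1, h]
  simp [Real.fourierInv_eq_fourier_comp_neg]

theorem fourierInv_continuous {H : V → ℂ} (hH : Integrable H) : Continuous (𝓕⁻ H) := by
  have h : Continuous (𝓕 H) := VectorFourier.fourierIntegral_continuous
    Real.continuous_fourierChar continuous_inner hH
  have h2 : 𝓕⁻ H = fun x => 𝓕 H (-x) := funext fun x => Real.fourierInv_eq_fourier_neg H x
  rw [h2]
  exact h.comp continuous_neg

/-- The Fourier transforms on `L¹` and `L²` agree: if `f ∈ L²` is the inverse Fourier integral of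
an integrable function `H`, then its Fourier transform is `H`. -/
theorem fourier_ae_eq {H : V → ℂ} (hH : Integrable H) (f : Lp ℂ 2 (volume : Measure V))
    (h : f =ᵐ[volume] 𝓕⁻ H) : (𝓕 f : Lp ℂ 2 (volume : Measure V)) =ᵐ[volume] H := by
  refine ae_eq_of_integral_schwartz (locallyIntegrable _) hH.locallyIntegrable fun s _ => ?_
  rw [← integral_fourier_mul]
  have h1 : ∫ x, 𝓕 s x * f x = ∫ x, 𝓕 s x * 𝓕⁻ H x :=
    integral_congr_ae (h.mono fun x hx => by simp only [hx])
  rw [h1, ← integral_fourierInv_mul_of_integrable hH]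
  simp

/-- Fourier inversion for `f ∈ L²` with integrable Fourier transform. -/
theorem ae_eq_fourierInv (f : Lp ℂ 2 (volume : Measure V))
    (h : Integrable (𝓕 f : Lp ℂ 2 (volume : Measure V))) :
    f =ᵐ[volume] 𝓕⁻ ((𝓕 f : Lp ℂ 2 (volume : Measure V)) : V → ℂ) := by
  refine ae_eq_of_integral_schwartz (locallyIntegrable _)
    (fourierInv_continuous h).locallyIntegrable fun s _ => ?_
  rw [← integral_fourierInv_mul_of_integrable h, ← integral_fourier_mul]
  simp

/-- The Fourier transform of the complex conjugate. -/
theorem fourier_conj_ae_eq (f g : Lp ℂ 2 (volume : Measure V))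
    (h : g =ᵐ[volume] fun x => conj (f x)) :
    (𝓕 g : Lp ℂ 2 (volume : Measure V)) =ᵐ[volume]
      fun ξ => conj ((𝓕 f : Lp ℂ 2 (volume : Measure V)) (-ξ)) := by
  have hm : LocallyIntegrable
      (fun ξ => conj ((𝓕 f : Lp ℂ 2 (volume : Measure V)) (-ξ))) volume := by
    have h2 : MemLp (fun ξ => conj ((𝓕 f : Lp ℂ 2 (volume : Measure V)) (-ξ))) 2 volume :=
      ((Lp.memLp (𝓕 f)).comp_measurePreserving (Measure.measurePreserving_neg volume)).star
    exact h2.locallyIntegrable (by norm_num)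
  refine ae_eq_of_integral_schwartz (locallyIntegrable _) hm fun s hs => ?_
  -- This is where the test function has to be real.
  have hF (x : V) : conj (𝓕 s x) = 𝓕⁻ s x := by
    simp only [SchwartzMap.fourierInv_coe, SchwartzMap.fourier_coe, Real.fourier_eq,
      Real.fourierInv_eq, ← integral_conj]
    refine integral_congr_ae (.of_forall fun v => ?_)
    simp only [Circle.smul_def, smul_eq_mul, map_mul, hs]
    congr 1
    rw [← Circle.coe_inv_eq_conj, ← AddChar.map_neg_eq_inv, neg_neg]
  rw [← integral_fourier_mul]
  calc ∫ x, 𝓕 s x * g x = ∫ x, conj (𝓕⁻ s x * f x) := by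
        refine integral_congr_ae (h.mono fun x hx => ?_)
        simp only [hx, map_mul, ← hF, Complex.conj_conj]
    _ = conj (∫ x, 𝓕 s (-x) * f x) := by
        rw [integral_conj]
        simp only [SchwartzMap.fourierInv_coe, SchwartzMap.fourier_coe,
          Real.fourierInv_eq_fourier_neg]
    _ = conj (∫ x, s (-x) * (𝓕 f : Lp ℂ 2 (volume : Measure V)) x) := by
        let s' : 𝓢(V, ℂ) := SchwartzMap.compCLMOfContinuousLinearEquiv ℂ
          (ContinuousLinearEquiv.neg ℝ) s
        have hs' : (s' : V → ℂ) = s ∘ fun x => -x := rfl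
        have h1 := integral_fourier_mul f s'
        have h2 (x : V) : 𝓕 s' x = 𝓕 s (-x) := by
          rw [SchwartzMap.fourier_coe, SchwartzMap.fourier_coe, hs',
            ← Real.fourierInv_eq_fourier_neg, Real.fourierInv_eq_fourier_comp_neg]
          rfl
        simp only [h2] at h1
        rw [h1]
        rfl
    _ = _ := by
        rw [← integral_conj, ← integral_neg_eq_self]
        simp [hs]

/-! ### Fourier supports of products. -/

open Convolution in
-- Since `‖ξ‖ ≤ ‖η‖ + ‖ξ - η‖`, one of the two factors vanishes for almost every `η`.
theorem convolution_ae_eq_zero {F G : V → ℂ} {a b : ℝ}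
    (hF : ∀ᵐ ξ, a ≤ 2 * Real.pi * ‖ξ‖ → F ξ = 0) (hG : ∀ᵐ ξ, b ≤ 2 * Real.pi * ‖ξ‖ → G ξ = 0)
    (ξ : V) (hξ : a + b ≤ 2 * Real.pi * ‖ξ‖) :
    (F ⋆[ContinuousLinearMap.mul ℂ ℂ, volume] G) ξ = 0 := by
  rw [convolution_def]
  refine integral_eq_zero_of_ae ?_
  filter_upwards [hF, (Measure.measurePreserving_sub_left volume ξ).quasiMeasurePreserving.ae hG]
    with η h1 h2
  simp only [ContinuousLinearMap.mul_apply', Pi.zero_apply, mul_eq_zero]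
  by_contra! h
  have h3 : 2 * Real.pi * ‖η‖ < a := not_le.1 fun h' => h.1 (h1 h')
  have h4 : 2 * Real.pi * ‖ξ - η‖ < b := not_le.1 fun h' => h.2 (h2 h')
  have h5 : ‖ξ‖ ≤ ‖η‖ + ‖ξ - η‖ := by simpa using norm_add_le η (ξ - η)
  have := mul_le_mul_of_nonneg_left h5 Real.two_pi_pos.le
  linarith

/-- An `L²` function with Fourier transform vanishing outside a ball has an integrable Fourier
transform. -/
theorem integrable_of_ae_eq_zero {F : V → ℂ} (hF : MemLp F 2 volume) {a : ℝ}
    (h : ∀ᵐ ξ, a ≤ 2 * Real.pi * ‖ξ‖ → F ξ = 0) : Integrable F := by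
  let B : Set V := Metric.ball 0 (a / (2 * Real.pi))
  have hB : volume B ≠ ∞ := measure_ball_lt_top.ne
  have h1 : IntegrableOn F B :=
    haveI : IsFiniteMeasure (volume.restrict B) := ⟨by simpa using hB.lt_top⟩
    (hF.restrict B).integrable (by norm_num)
  have h2 : F =ᵐ[volume] B.indicator F := by
    filter_upwards [h] with ξ hξ
    by_cases hb : ξ ∈ B
    · simp [hb]
    · rw [Set.indicator_of_notMem hb]
      refine hξ ?_
      simp only [B, Metric.mem_ball, dist_zero_right, not_lt] at hb
      rwa [div_le_iff₀' Real.two_pi_pos] at hb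
  exact ((integrable_indicator_iff measurableSet_ball).2 h1).congr h2.symm

/-- The Fourier support of a product lies in the sum of the Fourier supports. -/
theorem fourier_mul_eq_zero {f g p : Lp ℂ 2 (volume : Measure V)} {a b : ℝ}
    (hp : p =ᵐ[volume] fun x => f x * g x)
    (hf : ∀ᵐ ξ, a ≤ 2 * Real.pi * ‖ξ‖ → (𝓕 f : Lp ℂ 2 (volume : Measure V)) ξ = 0)
    (hg : ∀ᵐ ξ, b ≤ 2 * Real.pi * ‖ξ‖ → (𝓕 g : Lp ℂ 2 (volume : Measure V)) ξ = 0) :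
    ∀ᵐ ξ, a + b ≤ 2 * Real.pi * ‖ξ‖ → (𝓕 p : Lp ℂ 2 (volume : Measure V)) ξ = 0 := by
  have hF := integrable_of_ae_eq_zero (Lp.memLp _) hf
  have hG := integrable_of_ae_eq_zero (Lp.memLp _) hg
  have hH := hF.integrable_convolution (ContinuousLinearMap.mul ℂ ℂ) hG
  have h : p =ᵐ[volume] 𝓕⁻ (convolution (𝓕 f : Lp ℂ 2 (volume : Measure V))
      (𝓕 g : Lp ℂ 2 (volume : Measure V)) (ContinuousLinearMap.mul ℂ ℂ) volume) := by
    filter_upwards [hp, ae_eq_fourierInv f hF, ae_eq_fourierInv g hG] with x h1 h2 h3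
    rw [h1, h2, h3]
    simp only [Real.fourierInv_eq_fourier_neg]
    rw [Real.fourier_mul_convolution_eq hF hG]
  filter_upwards [fourier_ae_eq hH p h] with ξ h1 h2
  rw [h1]
  exact convolution_ae_eq_zero hf hg ξ h2

/-! ### Frequency tails, the Wiener norm, and the tail of a product. -/

/-- The `L²` norm of the part of `f` with frequencies at least `R`. -/
noncomputable def tail (R : ℝ) (f : Lp ℂ 2 (volume : Measure V)) : ℝ≥0∞ :=
  eLpNorm ({ξ : V | R ≤ 2 * Real.pi * ‖ξ‖}.indicator (𝓕 f : Lp ℂ 2 (volume : Measure V))) 2 volume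

/-- The norm `‖𝓕 f‖_{L¹}` of the Wiener algebra. -/
noncomputable def wiener (f : Lp ℂ 2 (volume : Measure V)) : ℝ≥0∞ :=
  eLpNorm (𝓕 f : Lp ℂ 2 (volume : Measure V)) 1 volume

omit [InnerProductSpace ℝ V] [FiniteDimensional ℝ V] in
theorem measurableSet_le_norm (R : ℝ) : MeasurableSet {ξ : V | R ≤ 2 * Real.pi * ‖ξ‖} :=
  (isClosed_le continuous_const (by fun_prop)).measurableSet

theorem tail_le_enorm (R : ℝ) (f : Lp ℂ 2 (volume : Measure V)) : tail R f ≤ ‖f‖ₑ := by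
  refine (eLpNorm_indicator_le _).trans_eq ?_
  rw [← Lp.enorm_def, ← ofReal_norm, ← ofReal_norm, Lp.norm_fourier_eq]

theorem tail_antitone (f : Lp ℂ 2 (volume : Measure V)) : Antitone fun R => tail R f := by
  intro R R' h
  refine eLpNorm_mono fun ξ => ?_
  exact norm_indicator_le_of_subset (fun ξ (hξ : R' ≤ _) => h.trans hξ) _ _

theorem tail_add_le (R : ℝ) (f g : Lp ℂ 2 (volume : Measure V)) :
    tail R (f + g) ≤ tail R f + tail R g := by
  have h : ({ξ : V | R ≤ 2 * Real.pi * ‖ξ‖}.indicator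
      (𝓕 (f + g) : Lp ℂ 2 (volume : Measure V))) =ᵐ[volume]
      ({ξ : V | R ≤ 2 * Real.pi * ‖ξ‖}.indicator (𝓕 f : Lp ℂ 2 (volume : Measure V))) +
      ({ξ : V | R ≤ 2 * Real.pi * ‖ξ‖}.indicator (𝓕 g : Lp ℂ 2 (volume : Measure V))) := by
    rw [FourierTransform.fourier_add, ← Set.indicator_add']
    filter_upwards [Lp.coeFn_add (𝓕 f) (𝓕 g)] with ξ h
    simp only [Set.indicator_apply, h]
  rw [tail, eLpNorm_congr_ae h]
  exact eLpNorm_add_le ((Lp.aestronglyMeasurable _).indicator (measurableSet_le_norm R))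
    ((Lp.aestronglyMeasurable _).indicator (measurableSet_le_norm R)) (by norm_num)

theorem tail_eq_zero {R : ℝ} {f : Lp ℂ 2 (volume : Measure V)}
    (h : ∀ᵐ ξ, R ≤ 2 * Real.pi * ‖ξ‖ → (𝓕 f : Lp ℂ 2 (volume : Measure V)) ξ = 0) :
    tail R f = 0 := by
  rw [tail, eLpNorm_eq_zero_iff ((Lp.aestronglyMeasurable _).indicator (measurableSet_le_norm R))
    (by norm_num)]
  filter_upwards [h] with ξ hξ
  exact Set.indicator_apply_eq_zero.2 hξ

theorem eLpNorm_top_le_wiener (f : Lp ℂ 2 (volume : Measure V)) :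
    eLpNorm f ∞ volume ≤ wiener f := by
  by_cases h : wiener f = ∞
  · simp [h]
  have hi : Integrable (𝓕 f : Lp ℂ 2 (volume : Measure V)) :=
    memLp_one_iff_integrable.1 ⟨Lp.aestronglyMeasurable _, lt_top_iff_ne_top.2 h⟩
  rw [eLpNorm_congr_ae (ae_eq_fourierInv f hi), eLpNorm_exponent_top]
  refine eLpNormEssSup_le_of_ae_enorm_bound (.of_forall fun x => ?_)
  rw [Real.fourierInv_eq, wiener, eLpNorm_one_eq_lintegral_enorm]
  refine (enorm_integral_le_lintegral_enorm _).trans_eq ?_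
  refine lintegral_congr fun a => ?_
  rw [← ofReal_norm, ← ofReal_norm, Circle.norm_smul]

/-- The splitting of `f` into frequencies below and above `a`. -/
theorem exists_split (a : ℝ) (f : Lp ℂ 2 (volume : Measure V)) :
    ∃ f₁ f₂ : Lp ℂ 2 (volume : Measure V), f = f₁ + f₂ ∧
      (∀ᵐ ξ, a ≤ 2 * Real.pi * ‖ξ‖ → (𝓕 f₁ : Lp ℂ 2 (volume : Measure V)) ξ = 0) ∧
      wiener f₁ ≤ wiener f ∧ ‖f₂‖ₑ = tail a f := by
  let S := {ξ : V | a ≤ 2 * Real.pi * ‖ξ‖}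
  have hS : MeasurableSet S := measurableSet_le_norm a
  have m1 : MemLp (Sᶜ.indicator (𝓕 f : Lp ℂ 2 (volume : Measure V))) 2 volume :=
    (Lp.memLp _).indicator hS.compl
  have m2 : MemLp (S.indicator (𝓕 f : Lp ℂ 2 (volume : Measure V))) 2 volume :=
    (Lp.memLp _).indicator hS
  refine ⟨𝓕⁻ (m1.toLp _), 𝓕⁻ (m2.toLp _), ?_, ?_, ?_, ?_⟩
  · rw [← FourierTransform.fourierInv_add, ← MemLp.toLp_add]
    simp only [Set.indicator_compl_add_self, Lp.toLp_coeFn]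
    simp
  · rw [FourierTransform.fourier_fourierInv_eq]
    filter_upwards [m1.coeFn_toLp] with ξ h1 h2
    rw [h1]
    exact Set.indicator_of_notMem (by simpa [S] using h2) _
  · rw [wiener, FourierTransform.fourier_fourierInv_eq, eLpNorm_congr_ae m1.coeFn_toLp]
    exact eLpNorm_indicator_le _
  · rw [← ofReal_norm, ← Lp.norm_fourier_eq, FourierTransform.fourier_fourierInv_eq, ofReal_norm,
      Lp.enorm_def, eLpNorm_congr_ae m2.coeFn_toLp]
    rfl

theorem memLp_mul {f g : V → ℂ} (hf : MemLp f 2 volume) (hg : MemLp g ∞ volume) :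
    MemLp (fun x => f x * g x) 2 volume :=
  MemLp.mul (p := 2) (q := ∞) (r := 2) hg hf

theorem enorm_mul_le {f g p : Lp ℂ 2 (volume : Measure V)}
    (hp : p =ᵐ[volume] fun x => f x * g x) : ‖p‖ₑ ≤ ‖f‖ₑ * eLpNorm g ∞ volume := by
  rw [Lp.enorm_def, Lp.enorm_def, eLpNorm_congr_ae hp]
  have h := eLpNorm_smul_le_mul_eLpNorm (p := 2) (q := ∞) (r := 2)
    (Lp.aestronglyMeasurable g) (Lp.aestronglyMeasurable f)
  exact h

/-- The frequency tail of a product. -/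
theorem tail_mul_le {f g p : Lp ℂ 2 (volume : Measure V)}
    (hp : p =ᵐ[volume] fun x => f x * g x) (hf : wiener f ≠ ∞) (hg : eLpNorm g ∞ volume ≠ ∞)
    (a b : ℝ) :
    tail (a + b) p ≤ wiener f * tail b g + eLpNorm g ∞ volume * tail a f := by
  obtain ⟨f₁, f₂, hf12, hf1, hwf, hf2⟩ := exists_split a f
  obtain ⟨g₁, g₂, hg12, hg1, -, hg2⟩ := exists_split b g
  have hf1top : eLpNorm f₁ ∞ volume ≤ wiener f := (eLpNorm_top_le_wiener f₁).trans hwf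
  have mf1 : MemLp f₁ ∞ volume := ⟨Lp.aestronglyMeasurable _, hf1top.trans_lt hf.lt_top⟩
  have mg : MemLp g ∞ volume := ⟨Lp.aestronglyMeasurable _, hg.lt_top⟩
  -- The splitting is `f g = f₁ g₁ + f₁ g₂ + f₂ g`. Keeping `g` whole in the last term means that
  -- only its sup norm enters; for the inverse, no Wiener bound on that factor is available.
  have m1 := memLp_mul (Lp.memLp g₁) mf1
  have m2 := memLp_mul (Lp.memLp g₂) mf1
  have m3 := memLp_mul (Lp.memLp f₂) mg
  have hsum : p = m1.toLp _ + (m2.toLp _ + m3.toLp _) := by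
    refine Lp.ext ?_
    rw [← MemLp.toLp_add, ← MemLp.toLp_add]
    refine hp.trans (.trans ?_ (MemLp.coeFn_toLp _).symm)
    filter_upwards [Lp.coeFn_add f₁ f₂, Lp.coeFn_add g₁ g₂] with x h1 h2
    rw [← hf12] at h1
    rw [← hg12] at h2
    simp only [Pi.add_apply] at h1 h2 ⊢
    linear_combination g x * h1 + f₁ x * h2
  have hz : tail (a + b) (m1.toLp _) = 0 := by
    refine tail_eq_zero (fourier_mul_eq_zero (f := f₁) (g := g₁) ?_ hf1 hg1)
    filter_upwards [m1.coeFn_toLp] with x hx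
    rw [hx, mul_comm]
  calc tail (a + b) p ≤ tail (a + b) (m1.toLp _) + (tail (a + b) (m2.toLp _) +
        tail (a + b) (m3.toLp _)) := by
        rw [hsum]
        exact (tail_add_le _ _ _).trans (by gcongr; exact tail_add_le _ _ _)
    _ ≤ 0 + (‖m2.toLp _‖ₑ + ‖m3.toLp _‖ₑ) := by
        rw [hz]
        gcongr <;> exact tail_le_enorm _ _
    _ ≤ ‖g₂‖ₑ * eLpNorm f₁ ∞ volume + ‖f₂‖ₑ * eLpNorm g ∞ volume := by
        rw [zero_add]
        gcongr
        · exact enorm_mul_le m2.coeFn_toLp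
        · exact enorm_mul_le m3.coeFn_toLp
    _ ≤ _ := by
        rw [hf2, hg2, mul_comm (tail b g), mul_comm (tail a f)]
        gcongr

end FourierL2

/-! ### Supports and telescoping sums of the dyadic partition. -/

namespace LPCutoff

theorem eq_zero (φ : LPCutoff) {r : ℝ} (h : 2 ≤ |r|) : φ.toFun r = 0 := by
  by_contra h0
  have := φ.tsupport_subset (subset_tsupport _ h0)
  exact absurd (abs_lt.2 this) (not_lt.2 h)

theorem dyadic_eq_zero_of_le (φ : LPCutoff) (k : ℕ) {r : ℝ} (h : 2 ^ (k + 1) ≤ |r|) :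
    φ.dyadic k r = 0 := by
  cases k with
  | zero => exact φ.eq_zero (by simpa using h)
  | succ k =>
    have h2 : (2 : ℝ) ^ (k + 1 + 1) = 2 * 2 ^ (k + 1) := by ring
    have h3 : 2 ≤ |r / 2 ^ (k + 1)| := by
      rw [abs_div, abs_of_pos (by positivity : (0 : ℝ) < 2 ^ (k + 1)), le_div_iff₀ (by positivity)]
      linarith
    rw [dyadic, φ.eq_zero h3, φ.eq_zero, sub_zero]
    rw [abs_mul, abs_two]
    linarith [abs_nonneg (r / 2 ^ (k + 1))]

theorem dyadic_succ_eq_zero_of_ge (φ : LPCutoff) (k : ℕ) {r : ℝ} (h : |r| ≤ 2 ^ k) :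
    φ.dyadic (k + 1) r = 0 := by
  have h1 : |2 * (r / 2 ^ (k + 1))| ≤ 1 := by
    have : 2 * (r / 2 ^ (k + 1)) = r / 2 ^ k := by rw [pow_succ]; field_simp
    rw [this, abs_div, abs_of_pos (by positivity : (0 : ℝ) < 2 ^ k)]
    exact div_le_one_of_le₀ h (by positivity)
  have h2 : |r / 2 ^ (k + 1)| ≤ 1 := by
    rw [abs_mul, abs_two] at h1
    linarith [abs_nonneg (r / 2 ^ (k + 1))]
  rw [dyadic, φ.eq_one _ (abs_le.1 h1), φ.eq_one _ (abs_le.1 h2), sub_self]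

theorem sum_dyadic (φ : LPCutoff) (K : ℕ) (r : ℝ) :
    ∑ k ∈ Finset.range (K + 1), φ.dyadic k r = φ.toFun (r / 2 ^ K) := by
  induction K with
  | zero => simp [dyadic]
  | succ K ih =>
    rw [Finset.sum_range_succ, ih, dyadic]
    have : 2 * (r / 2 ^ (K + 1)) = r / 2 ^ K := by rw [pow_succ]; field_simp
    rw [this]
    ring

theorem eventually_sum_dyadic (φ : LPCutoff) (r : ℝ) :
    ∀ᶠ K in Filter.atTop, ∑ k ∈ Finset.range K, φ.dyadic k r = 1 := by
  obtain ⟨N, hN⟩ := pow_unbounded_of_one_lt |r| (one_lt_two (α := ℝ))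
  filter_upwards [Filter.eventually_ge_atTop (N + 1)] with K hK
  obtain ⟨m, rfl⟩ : ∃ m, K = m + 1 := ⟨K - 1, by omega⟩
  rw [φ.sum_dyadic]
  refine φ.eq_one _ (abs_le.1 ?_)
  rw [abs_div, abs_of_pos (by positivity : (0 : ℝ) < 2 ^ m)]
  refine div_le_one_of_le₀ (hN.le.trans ?_) (by positivity)
  exact pow_le_pow_right₀ one_le_two (by omega)

end LPCutoff

/-! ### The Besov norm as a weighted integral of tails, and its embedding into the Wiener algebra.
-/

namespace FourierL2

/-- The weighted integral `∫₀^∞ R ^ (σ - 1) ‖1_{|ξ| ≥ R} 𝓕 f‖_{L²} dR`. -/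
noncomputable def tailIntegral {V : Type*} [NormedAddCommGroup V] [InnerProductSpace ℝ V]
    [FiniteDimensional ℝ V] [MeasurableSpace V] [BorelSpace V] (σ : ℝ)
    (f : Lp ℂ 2 (volume : Measure V)) : ℝ≥0∞ :=
  ∫⁻ R in Set.Ioi (0 : ℝ), ENNReal.ofReal (R ^ (σ - 1)) * tail R f

theorem lintegral_rpow_Ioc {σ a b : ℝ} (hσ : 0 < σ) (ha : 0 ≤ a) (hab : a ≤ b) :
    ∫⁻ R in Set.Ioc a b, ENNReal.ofReal (R ^ (σ - 1)) = ENNReal.ofReal ((b ^ σ - a ^ σ) / σ) := by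
  have hi : IntervalIntegrable (fun R : ℝ => R ^ (σ - 1)) volume a b :=
    intervalIntegral.intervalIntegrable_rpow' (by linarith)
  rw [intervalIntegrable_iff_integrableOn_Ioc_of_le hab] at hi
  rw [← ofReal_integral_eq_lintegral_ofReal hi, ← intervalIntegral.integral_of_le hab,
    integral_rpow (Or.inl (by linarith)), sub_add_cancel]
  refine (ae_restrict_mem measurableSet_Ioc).mono fun R hR => ?_
  exact Real.rpow_nonneg (ha.trans hR.1.le) _

variable {n : ℕ}

theorem enorm_proj (φ : LPCutoff) (k : ℕ)
    (f : Lp ℂ 2 (volume : Measure (EuclideanSpace ℝ (Fin n)))) :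
    ‖φ.proj k f‖ₑ = eLpNorm (fun ξ => (φ.dyadic k (2 * Real.pi * ‖ξ‖) : ℂ) *
      (𝓕 f : Lp ℂ 2 (volume : Measure (EuclideanSpace ℝ (Fin n)))) ξ) 2 volume := by
  rw [LPCutoff.proj, ← ofReal_norm, ← Lp.norm_fourier_eq, FourierTransform.fourier_fourierInv_eq,
    ofReal_norm, Lp.enorm_def, eLpNorm_congr_ae (MemLp.coeFn_toLp _)]

theorem abs_two_pi_norm (ξ : EuclideanSpace ℝ (Fin n)) :
    |2 * Real.pi * ‖ξ‖| = 2 * Real.pi * ‖ξ‖ :=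
  abs_of_nonneg (mul_nonneg Real.two_pi_pos.le (norm_nonneg _))

theorem enorm_proj_le (φ : LPCutoff) (k : ℕ)
    (f : Lp ℂ 2 (volume : Measure (EuclideanSpace ℝ (Fin n)))) : ‖φ.proj k f‖ₑ ≤ ‖f‖ₑ := by
  rw [enorm_proj, ← ofReal_norm, ← Lp.norm_fourier_eq, ofReal_norm, Lp.enorm_def]
  refine eLpNorm_mono fun ξ => ?_
  rw [norm_mul, Complex.norm_real, Real.norm_eq_abs]
  exact mul_le_of_le_one_left (norm_nonneg _) (φ.abs_dyadic_le k _)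

theorem enorm_proj_succ_le (φ : LPCutoff) (k : ℕ)
    (f : Lp ℂ 2 (volume : Measure (EuclideanSpace ℝ (Fin n)))) :
    ‖φ.proj (k + 1) f‖ₑ ≤ tail (2 ^ k) f := by
  rw [enorm_proj, tail]
  refine eLpNorm_mono fun ξ => ?_
  by_cases h : (2 : ℝ) ^ k ≤ 2 * Real.pi * ‖ξ‖
  · rw [Set.indicator_of_mem (s := {ξ : EuclideanSpace ℝ (Fin n) | 2 ^ k ≤ 2 * Real.pi * ‖ξ‖}) h,
      norm_mul, Complex.norm_real, Real.norm_eq_abs]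
    exact mul_le_of_le_one_left (norm_nonneg _) (φ.abs_dyadic_le _ _)
  · rw [φ.dyadic_succ_eq_zero_of_ge k (by rw [abs_two_pi_norm]; exact (not_le.1 h).le)]
    simp

/-- At each frequency the partial sums of the partition are eventually `1`, so Fatou's lemma and the
triangle inequality apply, with no finiteness assumed. The case `p = 2` serves the `L²` norm and the
tails, `p = 1` the Wiener norm. -/
theorem eLpNorm_indicator_le_tsum (φ : LPCutoff) {F : EuclideanSpace ℝ (Fin n) → ℂ}
    (hF : AEStronglyMeasurable F volume) {S : Set (EuclideanSpace ℝ (Fin n))}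
    (hS : MeasurableSet S) {p : ℝ≥0∞} (hp : 1 ≤ p) :
    eLpNorm (S.indicator F) p volume ≤
      ∑' k, eLpNorm (S.indicator fun ξ => (φ.dyadic k (2 * Real.pi * ‖ξ‖) : ℂ) * F ξ) p volume := by
  let g : ℕ → EuclideanSpace ℝ (Fin n) → ℂ := fun k =>
    S.indicator fun ξ => (φ.dyadic k (2 * Real.pi * ‖ξ‖) : ℂ) * F ξ
  have hg (k : ℕ) : AEStronglyMeasurable (g k) volume := by
    have hc : Continuous fun ξ : EuclideanSpace ℝ (Fin n) =>
        (φ.dyadic k (2 * Real.pi * ‖ξ‖) : ℂ) := by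
      have h := φ.continuous_dyadic k
      fun_prop
    exact (hc.aestronglyMeasurable.mul hF).indicator hS
  have hlim : ∀ᵐ ξ, Filter.Tendsto (fun K => (∑ k ∈ Finset.range K, g k) ξ) Filter.atTop
      (nhds (S.indicator F ξ)) := by
    refine .of_forall fun ξ => tendsto_const_nhds.congr' ?_
    filter_upwards [φ.eventually_sum_dyadic (2 * Real.pi * ‖ξ‖)] with K hK
    by_cases hξ : ξ ∈ S
    · simp only [Finset.sum_apply, g, Set.indicator_of_mem hξ, ← Finset.sum_mul,
        ← Complex.ofReal_sum, hK, Complex.ofReal_one, one_mul]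
    · simp [Finset.sum_apply, g, Set.indicator_of_notMem hξ]
  refine (Lp.eLpNorm_lim_le_liminf_eLpNorm
    (fun K => Finset.aestronglyMeasurable_sum _ fun k _ => hg k) _ hlim).trans ?_
  refine Filter.liminf_le_of_frequently_le' (.of_forall fun K => ?_)
  exact (eLpNorm_sum_le (fun k _ => hg k) hp).trans (ENNReal.sum_le_tsum _)

/-- The Besov norm on `L²`. -/
noncomputable def besov (φ : LPCutoff) (σ : ℝ)
    (f : Lp ℂ 2 (volume : Measure (EuclideanSpace ℝ (Fin n)))) : ℝ≥0∞ :=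
  ∑' k : ℕ, ENNReal.ofReal ((2 : ℝ) ^ (σ * (k : ℝ))) * ‖φ.proj k f‖ₑ

theorem besov_mono (φ : LPCutoff) {σ σ' : ℝ} (h : σ ≤ σ')
    (f : Lp ℂ 2 (volume : Measure (EuclideanSpace ℝ (Fin n)))) :
    besov φ σ f ≤ besov φ σ' f := by
  refine ENNReal.tsum_le_tsum fun k => ?_
  gcongr
  exact one_le_two

theorem enorm_le_besov (φ : LPCutoff) {σ : ℝ} (hσ : 0 ≤ σ)
    (f : Lp ℂ 2 (volume : Measure (EuclideanSpace ℝ (Fin n)))) : ‖f‖ₑ ≤ besov φ σ f := by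
  have h := eLpNorm_indicator_le_tsum φ (Lp.aestronglyMeasurable (𝓕 f)) MeasurableSet.univ
    (p := 2) (by norm_num)
  simp only [Set.indicator_univ, ← enorm_proj, ← Lp.enorm_def] at h
  rw [← ofReal_norm, Lp.norm_fourier_eq, ofReal_norm] at h
  refine h.trans (ENNReal.tsum_le_tsum fun k => le_mul_of_one_le_left zero_le ?_)
  rw [← ENNReal.ofReal_one]
  exact ENNReal.ofReal_le_ofReal (Real.one_le_rpow one_le_two (by positivity))

/-- Blocks with `2 ^ (k + 1) < R` live at frequencies below `R` and contribute nothing. -/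
theorem tail_le_tsum (φ : LPCutoff) {R : ℝ} (hR : 0 < R)
    (f : Lp ℂ 2 (volume : Measure (EuclideanSpace ℝ (Fin n)))) :
    tail R f ≤ ∑' k : ℕ, (Set.Ioc (0 : ℝ) (2 ^ (k + 1))).indicator
      (fun _ => ‖φ.proj k f‖ₑ) R := by
  refine (eLpNorm_indicator_le_tsum φ (Lp.aestronglyMeasurable (𝓕 f))
    (measurableSet_le_norm R) (by norm_num)).trans (ENNReal.tsum_le_tsum fun k => ?_)
  by_cases h : R ≤ 2 ^ (k + 1)
  · rw [Set.indicator_of_mem (Set.mem_Ioc.2 ⟨hR, h⟩), enorm_proj]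
    exact eLpNorm_indicator_le _
  · refine (le_of_eq ?_).trans zero_le
    rw [show ({ξ : EuclideanSpace ℝ (Fin n) | R ≤ 2 * Real.pi * ‖ξ‖}.indicator fun ξ =>
        (φ.dyadic k (2 * Real.pi * ‖ξ‖) : ℂ) *
          (𝓕 f : Lp ℂ 2 (volume : Measure (EuclideanSpace ℝ (Fin n)))) ξ) = 0 from ?_, eLpNorm_zero]
    funext ξ
    refine Set.indicator_apply_eq_zero.2 fun hξ => ?_
    rw [φ.dyadic_eq_zero_of_le k, Complex.ofReal_zero, zero_mul]
    rw [abs_two_pi_norm]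
    exact (not_le.1 h).le.trans hξ

theorem measurable_tail {V : Type*} [NormedAddCommGroup V] [InnerProductSpace ℝ V]
    [FiniteDimensional ℝ V] [MeasurableSpace V] [BorelSpace V]
    (f : Lp ℂ 2 (volume : Measure V)) : Measurable fun R => tail R f :=
  (tail_antitone f).measurable

theorem measurable_rpow_weight (σ : ℝ) : Measurable fun R : ℝ => ENNReal.ofReal (R ^ (σ - 1)) := by
  fun_prop

/-- Exchanging sum and integral, block `k` receives the weight `∫ R^(σ-1) dR` over `(0, 2 ^ (k +
1)]`, which is `2 ^ σ / σ` times `2 ^ (σ k)`. -/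
theorem tailIntegral_le_besov (φ : LPCutoff) {σ : ℝ} (hσ : 0 < σ)
    (f : Lp ℂ 2 (volume : Measure (EuclideanSpace ℝ (Fin n)))) :
    tailIntegral σ f ≤ ENNReal.ofReal (2 ^ σ / σ) * besov φ σ f := by
  have key (k : ℕ) : ∫⁻ R in Set.Ioi (0 : ℝ), ENNReal.ofReal (R ^ (σ - 1)) *
      (Set.Ioc (0 : ℝ) (2 ^ (k + 1))).indicator (fun _ => ‖φ.proj k f‖ₑ) R =
      ENNReal.ofReal (2 ^ σ / σ) * (ENNReal.ofReal (2 ^ (σ * (k : ℝ))) * ‖φ.proj k f‖ₑ) := by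
    have h1 : ∀ R : ℝ, ENNReal.ofReal (R ^ (σ - 1)) *
        (Set.Ioc (0 : ℝ) (2 ^ (k + 1))).indicator (fun _ => ‖φ.proj k f‖ₑ) R =
        (Set.Ioc (0 : ℝ) (2 ^ (k + 1))).indicator
          (fun R => ENNReal.ofReal (R ^ (σ - 1)) * ‖φ.proj k f‖ₑ) R := fun R => by
      by_cases h : R ∈ Set.Ioc (0 : ℝ) (2 ^ (k + 1)) <;> simp [h]
    simp only [h1]
    rw [lintegral_indicator measurableSet_Ioc, Measure.restrict_restrict measurableSet_Ioc,
      Set.inter_eq_left.2 Set.Ioc_subset_Ioi_self,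
      lintegral_mul_const _ (measurable_rpow_weight σ),
      lintegral_rpow_Ioc hσ le_rfl (by positivity), ← mul_assoc, ← ENNReal.ofReal_mul (by positivity),
      Real.zero_rpow hσ.ne', sub_zero]
    congr 2
    rw [← Real.rpow_natCast, ← Real.rpow_mul zero_le_two, div_mul_eq_mul_div,
      ← Real.rpow_add two_pos]
    push_cast
    ring_nf
  calc tailIntegral σ f ≤ ∫⁻ R in Set.Ioi (0 : ℝ), ∑' k : ℕ, ENNReal.ofReal (R ^ (σ - 1)) *
        (Set.Ioc (0 : ℝ) (2 ^ (k + 1))).indicator (fun _ => ‖φ.proj k f‖ₑ) R := by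
        refine setLIntegral_mono' measurableSet_Ioi fun R hR => ?_
        rw [ENNReal.tsum_mul_left]
        gcongr
        exact tail_le_tsum φ hR f
    _ = ∑' k : ℕ, ∫⁻ R in Set.Ioi (0 : ℝ), ENNReal.ofReal (R ^ (σ - 1)) *
        (Set.Ioc (0 : ℝ) (2 ^ (k + 1))).indicator (fun _ => ‖φ.proj k f‖ₑ) R := by
        refine lintegral_tsum fun k => Measurable.aemeasurable ?_
        exact (measurable_rpow_weight σ).mul (measurable_const.indicator measurableSet_Ioc)
    _ = _ := by
        simp only [key]
        rw [ENNReal.tsum_mul_left, besov]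

/-- Block `k + 1` is at most `tail (2 ^ k) f`, hence at most `tail R f` for all `R` in `(2 ^ (k -
1), 2 ^ k]`; these intervals are disjoint. Block `0` is bounded by `‖f‖₂`. -/
theorem besov_le_tailIntegral (φ : LPCutoff) {σ : ℝ} (hσ : 0 < σ) :
    ∃ C : ℝ≥0, ∀ f : Lp ℂ 2 (volume : Measure (EuclideanSpace ℝ (Fin n))),
      besov φ σ f ≤ ‖f‖ₑ + C * tailIntegral σ f := by
  have hlt : (2 : ℝ) ^ (-σ) < 1 := Real.rpow_lt_one_of_one_lt_of_neg one_lt_two (by linarith)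
  -- The weight has integral `2 ^ (σ k) (1 - 2 ^ (-σ)) / σ` over that interval; `c` turns it into `2
  -- ^ (σ (k + 1))`.
  let c : ℝ := 2 ^ σ * σ / (1 - 2 ^ (-σ))
  have hc : 0 ≤ c := div_nonneg (by positivity) (by linarith)
  refine ⟨c.toNNReal, fun f => ?_⟩
  let r : ℕ → ℝ := fun k => 2 ^ k / 2
  have hr : Monotone r := fun a b h => by
    simp only [r]
    gcongr
    exact one_le_two
  have hr0 (k : ℕ) : 0 < r k := by positivity
  have hrs (k : ℕ) : r (k + 1) = 2 ^ k := by simp only [r]; rw [pow_succ]; ring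
  have key (k : ℕ) : ENNReal.ofReal (2 ^ (σ * ((k + 1 : ℕ) : ℝ))) * ‖φ.proj (k + 1) f‖ₑ ≤
      ENNReal.ofReal c * ∫⁻ R in Set.Ioc (r k) (r (k + 1)),
        ENNReal.ofReal (R ^ (σ - 1)) * tail R f := by
    have h1 : ENNReal.ofReal ((r (k + 1) ^ σ - r k ^ σ) / σ) * tail (2 ^ k) f ≤
        ∫⁻ R in Set.Ioc (r k) (r (k + 1)), ENNReal.ofReal (R ^ (σ - 1)) * tail R f := by
      rw [← lintegral_rpow_Ioc hσ (hr0 k).le (hr k.le_succ),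
        ← lintegral_mul_const _ (measurable_rpow_weight σ)]
      refine setLIntegral_mono' measurableSet_Ioc fun R hR => ?_
      gcongr
      exact tail_antitone f (hR.2.trans_eq (hrs k))
    have h2 : c * ((r (k + 1) ^ σ - r k ^ σ) / σ) = 2 ^ (σ * ((k + 1 : ℕ) : ℝ)) := by
      have e1 : r (k + 1) ^ σ = 2 ^ (σ * (k : ℝ)) := by
        rw [hrs, ← Real.rpow_natCast, ← Real.rpow_mul zero_le_two, mul_comm]
      have e2 : r k ^ σ = 2 ^ (σ * (k : ℝ)) * 2 ^ (-σ) := by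
        simp only [r]
        rw [Real.div_rpow (by positivity) zero_le_two, ← Real.rpow_natCast,
          ← Real.rpow_mul zero_le_two, mul_comm (k : ℝ), Real.rpow_neg zero_le_two, div_eq_mul_inv]
      have e3 : (2 : ℝ) ^ (σ * ((k + 1 : ℕ) : ℝ)) = 2 ^ (σ * (k : ℝ)) * 2 ^ σ := by
        rw [← Real.rpow_add two_pos]; push_cast; ring_nf
      rw [e1, e2, e3]
      have h4 : (1 : ℝ) - 2 ^ (-σ) ≠ 0 := by linarith
      simp only [c]
      field_simp
    calc _ ≤ ENNReal.ofReal (c * ((r (k + 1) ^ σ - r k ^ σ) / σ)) * tail (2 ^ k) f := by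
          rw [h2]
          gcongr
          exact enorm_proj_succ_le φ k f
      _ ≤ _ := by
          rw [ENNReal.ofReal_mul hc, mul_assoc]
          gcongr
  rw [besov, tsum_eq_zero_add' ENNReal.summable]
  refine add_le_add ?_ ?_
  · simpa using enorm_proj_le φ 0 f
  · refine (ENNReal.tsum_le_tsum key).trans ?_
    rw [ENNReal.tsum_mul_left]
    change ENNReal.ofReal c * _ ≤ ENNReal.ofReal c * _
    gcongr
    have hd : Pairwise (Function.onFun Disjoint fun k => Set.Ioc (r k) (r (k + 1))) :=
      hr.pairwise_disjoint_on_Ioc_succ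
    rw [← lintegral_iUnion (fun _ => measurableSet_Ioc) hd]
    exact lintegral_mono_set (Set.iUnion_subset fun k R hR => (hr0 k).trans hR.1)

/-- Cauchy-Schwarz on the ball carrying block `k` costs the square root of its volume, of order `2 ^
(k n / 2)`. Summability in `ℓ¹` over `k` admits the endpoint `σ = n / 2`. -/
theorem wiener_le_besov (φ : LPCutoff) {σ : ℝ} (hσ : (n : ℝ) / 2 ≤ σ) :
    ∃ C : ℝ≥0, ∀ f : Lp ℂ 2 (volume : Measure (EuclideanSpace ℝ (Fin n))),
      wiener f ≤ C * besov φ σ f := by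
  let B := volume (Metric.ball (0 : EuclideanSpace ℝ (Fin n)) 1)
  have hB : B ^ (1 / 2 : ℝ) ≠ ∞ := ENNReal.rpow_ne_top_of_nonneg (by norm_num) measure_ball_lt_top.ne
  -- The support bound `2 ^ (k + 1)` expressed in the frequency variable of the kernel `exp (-2 π i
  -- ⟨x, ξ⟩)`.
  let r : ℕ → ℝ := fun k => 2 ^ (k + 1) / (2 * Real.pi)
  have hr0 (k : ℕ) : 0 < r k := by positivity
  have hr (k : ℕ) : r k ≤ 2 ^ k := by
    simp only [r]
    rw [div_le_iff₀ Real.two_pi_pos, pow_succ]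
    have := Real.pi_gt_three
    have h2 : (0 : ℝ) < 2 ^ k := by positivity
    nlinarith
  have key (k : ℕ) (f : Lp ℂ 2 (volume : Measure (EuclideanSpace ℝ (Fin n)))) :
      eLpNorm (fun ξ => (φ.dyadic k (2 * Real.pi * ‖ξ‖) : ℂ) *
        (𝓕 f : Lp ℂ 2 (volume : Measure (EuclideanSpace ℝ (Fin n)))) ξ) 1 volume ≤
      B ^ (1 / 2 : ℝ) * (ENNReal.ofReal (2 ^ (σ * (k : ℝ))) * ‖φ.proj k f‖ₑ) := by
    let G : EuclideanSpace ℝ (Fin n) → ℂ := fun ξ => (φ.dyadic k (2 * Real.pi * ‖ξ‖) : ℂ) *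
        (𝓕 f : Lp ℂ 2 (volume : Measure (EuclideanSpace ℝ (Fin n)))) ξ
    let S := Metric.ball (0 : EuclideanSpace ℝ (Fin n)) (r k)
    have hG : G = S.indicator G := by
      refine (Set.indicator_eq_self.2 fun ξ hξ => ?_).symm
      by_contra hS
      refine hξ ?_
      simp only [G]
      rw [φ.dyadic_eq_zero_of_le k, Complex.ofReal_zero, zero_mul]
      simp only [S, Metric.mem_ball, dist_zero_right, not_lt, r] at hS
      rwa [abs_two_pi_norm, ← div_le_iff₀' Real.two_pi_pos]
    have hmG : AEStronglyMeasurable G volume := (φ.memLp_dyadic_mul k (𝓕 f)).1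
    have h1 : eLpNorm G 1 volume ≤ eLpNorm G 2 volume * volume S ^ (1 / 2 : ℝ) := by
      have h := eLpNorm_le_eLpNorm_mul_rpow_measure_univ (p := 1) (q := 2) (by norm_num)
        (hmG.restrict (s := S))
      rw [← eLpNorm_indicator_eq_eLpNorm_restrict measurableSet_ball,
        ← eLpNorm_indicator_eq_eLpNorm_restrict measurableSet_ball, ← hG] at h
      norm_num at h
      exact h
    have h2 : volume S ^ (1 / 2 : ℝ) ≤ ENNReal.ofReal (2 ^ (σ * (k : ℝ))) * B ^ (1 / 2 : ℝ) := by
      simp only [S]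
      rw [Measure.addHaar_ball_of_pos volume _ (hr0 k), ENNReal.mul_rpow_of_nonneg _ _ (by norm_num)]
      gcongr
      rw [ENNReal.ofReal_rpow_of_nonneg (by positivity) (by norm_num)]
      refine ENNReal.ofReal_le_ofReal ?_
      rw [finrank_euclideanSpace_fin, ← Real.rpow_natCast, ← Real.rpow_mul (hr0 k).le]
      calc r k ^ ((n : ℝ) * (1 / 2)) ≤ (2 ^ k : ℝ) ^ ((n : ℝ) * (1 / 2)) := by
            gcongr
            exact hr k
        _ = 2 ^ ((k : ℝ) * ((n : ℝ) * (1 / 2))) := by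
            rw [← Real.rpow_natCast, ← Real.rpow_mul zero_le_two]
        _ ≤ _ := by
            refine Real.rpow_le_rpow_of_exponent_le one_le_two ?_
            rw [mul_comm]
            gcongr
            linarith
    calc eLpNorm G 1 volume ≤ eLpNorm G 2 volume * volume S ^ (1 / 2 : ℝ) := h1
      _ ≤ ‖φ.proj k f‖ₑ * (ENNReal.ofReal (2 ^ (σ * (k : ℝ))) * B ^ (1 / 2 : ℝ)) := by
          rw [enorm_proj]
          gcongr
      _ = _ := by ring
  refine ⟨(B ^ (1 / 2 : ℝ)).toNNReal, fun f => ?_⟩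
  have h := eLpNorm_indicator_le_tsum φ (Lp.aestronglyMeasurable (𝓕 f)) MeasurableSet.univ
    (p := 1) le_rfl
  simp only [Set.indicator_univ] at h
  rw [ENNReal.coe_toNNReal hB, besov, ← ENNReal.tsum_mul_left]
  exact h.trans (ENNReal.tsum_le_tsum fun k => key k f)

end FourierL2

/-! ### Products and inverses in terms of tail integrals. -/

namespace FourierL2

section Tail

variable {V : Type*} [NormedAddCommGroup V] [InnerProductSpace ℝ V] [FiniteDimensional ℝ V]
  [MeasurableSpace V] [BorelSpace V]

/-- The truncation of `tailIntegral` to frequencies `R ≤ M`. -/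
noncomputable def truncIntegral (σ M : ℝ) (f : Lp ℂ 2 (volume : Measure V)) : ℝ≥0∞ :=
  ∫⁻ R in Set.Ioc (0 : ℝ) M, ENNReal.ofReal (R ^ (σ - 1)) * tail R f

theorem truncIntegral_le (σ M : ℝ) (f : Lp ℂ 2 (volume : Measure V)) :
    truncIntegral σ M f ≤ tailIntegral σ f :=
  lintegral_mono_set Set.Ioc_subset_Ioi_self

theorem tailIntegral_le_of_trunc {σ : ℝ} {f : Lp ℂ 2 (volume : Measure V)} {C : ℝ≥0∞}
    (h : ∀ M, 0 < M → truncIntegral σ M f ≤ C) : tailIntegral σ f ≤ C := by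
  have hU : Set.Ioi (0 : ℝ) = ⋃ m : ℕ, Set.Ioc (0 : ℝ) (m + 1) := by
    ext x
    simp only [Set.mem_Ioi, Set.mem_iUnion, Set.mem_Ioc]
    refine ⟨fun hx => ?_, fun ⟨m, hm⟩ => hm.1⟩
    obtain ⟨m, hm⟩ := exists_nat_ge x
    exact ⟨m, hx, by linarith⟩
  have hmono : Monotone fun m : ℕ => Set.Ioc (0 : ℝ) (m + 1) := fun a b hab =>
    Set.Ioc_subset_Ioc_right (by gcongr)
  rw [tailIntegral, hU, setLIntegral_iUnion_of_directed _ hmono.directed_le]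
  exact iSup_le fun m => h _ (by positivity)

/-- Finite for every `f ∈ L²`, whatever its regularity: this permits absorbing a term before
`tailIntegral` is known to be finite. -/
theorem truncIntegral_lt_top {σ : ℝ} (hσ : 0 < σ) {M : ℝ} (hM : 0 < M)
    (f : Lp ℂ 2 (volume : Measure V)) : truncIntegral σ M f < ∞ := by
  calc truncIntegral σ M f ≤ ∫⁻ R in Set.Ioc (0 : ℝ) M, ENNReal.ofReal (R ^ (σ - 1)) * ‖f‖ₑ := by
        refine lintegral_mono fun R => ?_
        gcongr
        exact tail_le_enorm R f
    _ < ∞ := by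
        rw [lintegral_mul_const _ (measurable_rpow_weight σ), lintegral_rpow_Ioc hσ le_rfl hM.le]
        exact ENNReal.mul_lt_top ENNReal.ofReal_lt_top enorm_lt_top

/-- Substitution of `c R` for `R`; because `c ≤ 1` the new range stays inside `(0, M]`, so the
truncation is preserved. -/
theorem lintegral_tail_scale {σ c M : ℝ} (hc : 0 < c) (hc1 : c ≤ 1) (hM : 0 < M)
    (f : Lp ℂ 2 (volume : Measure V)) :
    ∫⁻ R in Set.Ioc (0 : ℝ) M, ENNReal.ofReal (R ^ (σ - 1)) * tail (c * R) f ≤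
      ENNReal.ofReal (c ^ (-σ)) * truncIntegral σ M f := by
  have himg : (fun R => c * R) '' Set.Ioc 0 M = Set.Ioc 0 (c * M) := by
    rw [Set.image_mul_left_Ioc hc, mul_zero]
  have h := lintegral_image_eq_lintegral_abs_deriv_mul (measurableSet_Ioc (a := (0 : ℝ)) (b := M))
    (f := fun R => c * R) (f' := fun _ => c)
    (fun x _ => by simpa using ((hasDerivAt_id x).const_mul c).hasDerivWithinAt)
    (mul_right_injective₀ hc.ne').injOn (fun R => ENNReal.ofReal (R ^ (σ - 1)) * tail R f)
  rw [himg] at h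
  have h2 : ∫⁻ R in Set.Ioc (0 : ℝ) M, ENNReal.ofReal (R ^ (σ - 1)) * tail (c * R) f =
      ENNReal.ofReal (c ^ (-σ)) *
        ∫⁻ R in Set.Ioc 0 (c * M), ENNReal.ofReal (R ^ (σ - 1)) * tail R f := by
    have hm : Measurable fun R : ℝ => ENNReal.ofReal |c| *
        (ENNReal.ofReal ((c * R) ^ (σ - 1)) * tail (c * R) f) := by
      have := (measurable_tail f).comp (measurable_const_mul c)
      have h3 := (measurable_rpow_weight σ).comp (measurable_const_mul c)
      exact (h3.mul this).const_mul _
    rw [h, ← lintegral_const_mul _ hm]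
    refine setLIntegral_congr_fun measurableSet_Ioc fun R hR => ?_
    rw [← mul_assoc, ← mul_assoc, ← ENNReal.ofReal_mul (by positivity),
      ← ENNReal.ofReal_mul (by positivity)]
    congr 2
    rw [abs_of_pos hc, Real.mul_rpow hc.le hR.1.le, ← mul_assoc]
    rw [show c ^ (-σ) * c * c ^ (σ - 1) = 1 from ?_, one_mul]
    nth_rewrite 2 [← Real.rpow_one c]
    rw [← Real.rpow_add hc, ← Real.rpow_add hc]
    simp
  rw [h2]
  gcongr
  exact lintegral_mono_set (Set.Ioc_subset_Ioc_right (mul_le_of_le_one_left hM.le hc1))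

/-- `tail_mul_le` with the cuts `θ R` and `(1 - θ) R`. The parameter `θ` stays free so that either
coefficient can be brought close to `1`, at the expense of the other. -/
theorem truncIntegral_mul_le {σ θ M : ℝ} (hθ0 : 0 < θ) (hθ1 : θ < 1) (hM : 0 < M)
    {f g p : Lp ℂ 2 (volume : Measure V)} (hp : p =ᵐ[volume] fun x => f x * g x)
    (hf : wiener f ≠ ∞) (hg : eLpNorm g ∞ volume ≠ ∞) :
    truncIntegral σ M p ≤
      wiener f * (ENNReal.ofReal ((1 - θ) ^ (-σ)) * truncIntegral σ M g) +
      eLpNorm g ∞ volume * (ENNReal.ofReal (θ ^ (-σ)) * truncIntegral σ M f) := by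
  have hm (c : ℝ) (q : Lp ℂ 2 (volume : Measure V)) :
      Measurable fun R : ℝ => ENNReal.ofReal (R ^ (σ - 1)) * tail (c * R) q :=
    (measurable_rpow_weight σ).mul ((measurable_tail q).comp (measurable_const_mul c))
  calc truncIntegral σ M p ≤ ∫⁻ R in Set.Ioc (0 : ℝ) M,
        (wiener f * (ENNReal.ofReal (R ^ (σ - 1)) * tail ((1 - θ) * R) g) +
        eLpNorm g ∞ volume * (ENNReal.ofReal (R ^ (σ - 1)) * tail (θ * R) f)) := by
        refine lintegral_mono fun R => ?_
        have h := tail_mul_le hp hf hg (θ * R) ((1 - θ) * R)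
        rw [show θ * R + (1 - θ) * R = R by ring] at h
        calc _ ≤ ENNReal.ofReal (R ^ (σ - 1)) * (wiener f * tail ((1 - θ) * R) g +
              eLpNorm g ∞ volume * tail (θ * R) f) := by gcongr
          _ = _ := by ring
    _ = wiener f * (∫⁻ R in Set.Ioc (0 : ℝ) M,
          ENNReal.ofReal (R ^ (σ - 1)) * tail ((1 - θ) * R) g) +
        eLpNorm g ∞ volume * (∫⁻ R in Set.Ioc (0 : ℝ) M,
          ENNReal.ofReal (R ^ (σ - 1)) * tail (θ * R) f) := by
        rw [lintegral_add_left ((hm _ g).const_mul _), lintegral_const_mul _ (hm _ g),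
          lintegral_const_mul _ (hm _ f)]
    _ ≤ _ := by
        gcongr
        · exact lintegral_tail_scale (by linarith) (by linarith) hM g
        · exact lintegral_tail_scale hθ0 hθ1.le hM f

theorem tailIntegral_mul_le {σ θ : ℝ} (hθ0 : 0 < θ) (hθ1 : θ < 1)
    {f g p : Lp ℂ 2 (volume : Measure V)} (hp : p =ᵐ[volume] fun x => f x * g x)
    (hf : wiener f ≠ ∞) (hg : eLpNorm g ∞ volume ≠ ∞) :
    tailIntegral σ p ≤
      wiener f * (ENNReal.ofReal ((1 - θ) ^ (-σ)) * tailIntegral σ g) +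
      eLpNorm g ∞ volume * (ENNReal.ofReal (θ ^ (-σ)) * tailIntegral σ f) := by
  refine tailIntegral_le_of_trunc fun M hM => ?_
  refine (truncIntegral_mul_le hθ0 hθ1 hM hp hf hg).trans ?_
  gcongr <;> exact truncIntegral_le σ M _

theorem tail_neg (R : ℝ) (f : Lp ℂ 2 (volume : Measure V)) : tail R (-f) = tail R f := by
  have h : 𝓕 (-f) = -𝓕 f := map_neg (Lp.fourierTransformₗᵢ V ℂ) f
  rw [tail, tail, h]
  refine eLpNorm_congr_norm_ae ?_
  filter_upwards [Lp.coeFn_neg (𝓕 f)] with ξ hξ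
  simp only [Set.indicator_apply]
  split_ifs
  · rw [hξ, Pi.neg_apply, norm_neg]
  · rfl

/-- If `u = -(h + h u)` with `h` small in the Wiener algebra, then `u` is as regular as `h`. -/
theorem tailIntegral_inverse_le {σ : ℝ} (hσ : 0 < σ) :
    ∃ C : ℝ≥0, ∀ h u p : Lp ℂ 2 (volume : Measure V), (p =ᵐ[volume] fun x => h x * u x) →
      u = -(h + p) → wiener h ≤ 1 / 2 → eLpNorm u ∞ volume ≤ 1 →
      tailIntegral σ u ≤ C * tailIntegral σ h := by
  -- Chosen so that `τ ^ (-σ) = 3 / 2`: with `wiener h ≤ 1 / 2`, the coefficient of the `u` term is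
  -- `3 / 4`.
  let τ : ℝ := (2 / 3) ^ (1 / σ)
  have hτ0 : 0 < τ := by positivity
  have hτ1 : τ < 1 := Real.rpow_lt_one (by norm_num) (by norm_num) (by positivity)
  have hτ : τ ^ (-σ) = 3 / 2 := by
    rw [← Real.rpow_mul (by norm_num), show 1 / σ * -σ = -1 by field_simp, Real.rpow_neg_one]
    norm_num
  let c : ℝ := (1 - τ) ^ (-σ)
  have hc : 0 ≤ c := Real.rpow_nonneg (by linarith) _
  -- The bound `x ≤ y + 3/4 x + c y`, with `x` finite, gives `x ≤ 4 (1 + c) y`.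
  refine ⟨(4 * (1 + c)).toNNReal, fun h u p hp hu hw hu1 => ?_⟩
  refine tailIntegral_le_of_trunc fun M hM => ?_
  have h1 : truncIntegral σ M u ≤ truncIntegral σ M h + truncIntegral σ M p := by
    have hm : Measurable fun R : ℝ => ENNReal.ofReal (R ^ (σ - 1)) * tail R h :=
      (measurable_rpow_weight σ).mul (measurable_tail h)
    rw [truncIntegral, truncIntegral, truncIntegral, ← lintegral_add_left hm]
    refine lintegral_mono fun R => ?_
    rw [← mul_add, hu, tail_neg]
    gcongr
    exact tail_add_le R h p
  have h2 := truncIntegral_mul_le (σ := σ) (θ := 1 - τ) (by linarith) (by linarith) hM hp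
    (hw.trans_lt (by norm_num)).ne (hu1.trans_lt (by norm_num)).ne
  rw [show 1 - (1 - τ) = τ by ring, hτ] at h2
  have fu := truncIntegral_lt_top hσ hM u
  have fh := truncIntegral_lt_top hσ hM h
  have h3 : truncIntegral σ M u ≤ truncIntegral σ M h +
      (1 / 2 * (ENNReal.ofReal (3 / 2) * truncIntegral σ M u) +
        1 * (ENNReal.ofReal c * truncIntegral σ M h)) := by
    refine h1.trans ?_
    gcongr
    refine h2.trans ?_
    gcongr
  calc truncIntegral σ M u ≤ ENNReal.ofReal (4 * (1 + c)) * truncIntegral σ M h := by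
        rw [← ENNReal.ofReal_toReal fu.ne, ← ENNReal.ofReal_toReal fh.ne] at h3 ⊢
        have e : (1 / 2 : ℝ≥0∞) = ENNReal.ofReal (1 / 2) := by
          rw [ENNReal.ofReal_div_of_pos two_pos]; simp
        have t1 := ENNReal.toReal_nonneg (a := truncIntegral σ M u)
        have t2 := ENNReal.toReal_nonneg (a := truncIntegral σ M h)
        generalize (truncIntegral σ M u).toReal = x at *
        generalize (truncIntegral σ M h).toReal = y at *
        rw [one_mul, e, ← ENNReal.ofReal_mul (by norm_num), ← ENNReal.ofReal_mul (by norm_num),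
          ← ENNReal.ofReal_mul hc, ← ENNReal.ofReal_add (by positivity) (by positivity),
          ← ENNReal.ofReal_add (by positivity) (by positivity),
          ENNReal.ofReal_le_ofReal_iff (by positivity)] at h3
        rw [← ENNReal.ofReal_mul (by positivity)]
        refine ENNReal.ofReal_le_ofReal ?_
        linarith
    _ ≤ _ := by
        change ENNReal.ofReal _ * _ ≤ ENNReal.ofReal _ * _
        gcongr
        exact truncIntegral_le σ M h

end Tail

/-! ### Algebra and inverse estimates for the Besov norm on `L²` classes. -/

section Besov

variable {n : ℕ}

theorem proj_add (φ : LPCutoff) (k : ℕ)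
    (f g : Lp ℂ 2 (volume : Measure (EuclideanSpace ℝ (Fin n)))) :
    φ.proj k (f + g) = φ.proj k f + φ.proj k g := by
  simp only [LPCutoff.proj]
  rw [← FourierTransform.fourierInv_add, ← MemLp.toLp_add]
  congr 1
  refine MemLp.toLp_congr _ _ ?_
  rw [FourierTransform.fourier_add]
  filter_upwards [Lp.coeFn_add (𝓕 f) (𝓕 g)] with ξ h
  simp only [h, Pi.add_apply, mul_add]

theorem proj_smul (φ : LPCutoff) (k : ℕ) (c : ℂ)
    (f : Lp ℂ 2 (volume : Measure (EuclideanSpace ℝ (Fin n)))) :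
    φ.proj k (c • f) = c • φ.proj k f := by
  simp only [LPCutoff.proj]
  rw [← FourierTransform.fourierInv_smul, ← MemLp.toLp_const_smul]
  congr 1
  refine MemLp.toLp_congr _ _ ?_
  rw [FourierTransform.fourier_smul]
  filter_upwards [Lp.coeFn_smul c (𝓕 f)] with ξ h
  simp only [h, Pi.smul_apply, smul_eq_mul]
  ring

theorem besov_add_le (φ : LPCutoff) (σ : ℝ)
    (f g : Lp ℂ 2 (volume : Measure (EuclideanSpace ℝ (Fin n)))) :
    besov φ σ (f + g) ≤ besov φ σ f + besov φ σ g := by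
  rw [besov, besov, besov, ← ENNReal.tsum_add]
  refine ENNReal.tsum_le_tsum fun k => ?_
  rw [← mul_add, proj_add]
  gcongr
  exact enorm_add_le _ _

theorem besov_smul (φ : LPCutoff) (σ : ℝ) (c : ℂ)
    (f : Lp ℂ 2 (volume : Measure (EuclideanSpace ℝ (Fin n)))) :
    besov φ σ (c • f) = ‖c‖ₑ * besov φ σ f := by
  rw [besov, besov, ← ENNReal.tsum_mul_left]
  refine tsum_congr fun k => ?_
  rw [proj_smul, enorm_smul]
  ring

open scoped ComplexConjugate in
theorem besov_conj (φ : LPCutoff) (σ : ℝ)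
    {f g : Lp ℂ 2 (volume : Measure (EuclideanSpace ℝ (Fin n)))}
    (h : g =ᵐ[volume] fun x => conj (f x)) : besov φ σ g = besov φ σ f := by
  refine tsum_congr fun k => ?_
  rw [enorm_proj, enorm_proj]
  congr 1
  -- Conjugation reflects and conjugates the transform; the multipliers are real and radial, so the
  -- block norms do not change.
  rw [← eLpNorm_comp_measurePreserving (p := 2) (φ.memLp_dyadic_mul k (𝓕 f)).1
    (Measure.measurePreserving_neg volume)]
  refine eLpNorm_congr_norm_ae ?_
  filter_upwards [fourier_conj_ae_eq f g h] with ξ hξ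
  simp [hξ]

theorem besov_mul_le (φ : LPCutoff) {σ : ℝ} (hσ0 : 0 < σ) (hσ : (n : ℝ) / 2 ≤ σ) :
    ∃ C : ℝ≥0, ∀ f g p : Lp ℂ 2 (volume : Measure (EuclideanSpace ℝ (Fin n))),
      (p =ᵐ[volume] fun x => f x * g x) → besov φ σ f ≠ ∞ → besov φ σ g ≠ ∞ →
      besov φ σ p ≤ C * (besov φ σ f * besov φ σ g) := by
  obtain ⟨A, hA⟩ := besov_le_tailIntegral (n := n) φ hσ0
  obtain ⟨W, hW⟩ := wiener_le_besov (n := n) φ hσ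
  let t : ℝ≥0 := ((1 / 2 : ℝ) ^ (-σ)).toNNReal
  let c : ℝ≥0 := (2 ^ σ / σ).toNNReal
  refine ⟨W + A * (2 * W * t * c), fun f g p hp hf hg => ?_⟩
  have hwf : wiener f ≠ ∞ := ne_top_of_le_ne_top (ENNReal.mul_ne_top ENNReal.coe_ne_top hf) (hW f)
  have hwg : wiener g ≠ ∞ := ne_top_of_le_ne_top (ENNReal.mul_ne_top ENNReal.coe_ne_top hg) (hW g)
  have hgt : eLpNorm g ∞ volume ≤ W * besov φ σ g := (eLpNorm_top_le_wiener g).trans (hW g)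
  have h1 : ‖p‖ₑ ≤ besov φ σ f * (W * besov φ σ g) := (enorm_mul_le hp).trans
    (mul_le_mul' (enorm_le_besov φ hσ0.le f) hgt)
  have h2 := tailIntegral_mul_le (σ := σ) (θ := 1 / 2) (by norm_num) (by norm_num) hp hwf
    (ne_top_of_le_ne_top hwg (eLpNorm_top_le_wiener g))
  rw [show (1 - 1 / 2 : ℝ) = 1 / 2 by norm_num] at h2
  have h3 (q : Lp ℂ 2 (volume : Measure (EuclideanSpace ℝ (Fin n)))) :
      tailIntegral σ q ≤ c * besov φ σ q := tailIntegral_le_besov φ hσ0 q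
  calc besov φ σ p ≤ ‖p‖ₑ + A * tailIntegral σ p := hA p
    _ ≤ besov φ σ f * (W * besov φ σ g) + A * (W * besov φ σ f * (t * (c * besov φ σ g)) +
        W * besov φ σ g * (t * (c * besov φ σ f))) := by
        gcongr
        refine h2.trans (add_le_add ?_ ?_)
        · exact mul_le_mul' (hW f) (mul_le_mul' le_rfl (h3 g))
        · exact mul_le_mul' hgt (mul_le_mul' le_rfl (h3 f))
    _ = _ := by push_cast; ring

theorem besov_inverse_le (φ : LPCutoff) {σ : ℝ} (hσ0 : 0 < σ) :
    ∃ C : ℝ≥0, ∀ h u p : Lp ℂ 2 (volume : Measure (EuclideanSpace ℝ (Fin n))),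
      (p =ᵐ[volume] fun x => h x * u x) → u = -(h + p) → wiener h ≤ 1 / 2 →
      eLpNorm u ∞ volume ≤ 1 → besov φ σ u ≤ C * besov φ σ h := by
  obtain ⟨A, hA⟩ := besov_le_tailIntegral (n := n) φ hσ0
  obtain ⟨B, hB⟩ := tailIntegral_inverse_le (V := EuclideanSpace ℝ (Fin n)) hσ0
  let c : ℝ≥0 := (2 ^ σ / σ).toNNReal
  refine ⟨2 + A * (B * c), fun h u p hp hu hw hu1 => ?_⟩
  have h1 : ‖u‖ₑ ≤ 2 * besov φ σ h := by
    calc ‖u‖ₑ ≤ ‖h‖ₑ + ‖p‖ₑ := by rw [hu, enorm_neg]; exact enorm_add_le _ _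
      _ ≤ ‖h‖ₑ + ‖h‖ₑ * 1 := by
          gcongr
          exact (enorm_mul_le hp).trans (by gcongr)
      _ = 2 * ‖h‖ₑ := by ring
      _ ≤ _ := by
          gcongr
          exact enorm_le_besov φ hσ0.le h
  have h3 : tailIntegral σ h ≤ c * besov φ σ h := tailIntegral_le_besov φ hσ0 h
  calc besov φ σ u ≤ ‖u‖ₑ + A * tailIntegral σ u := hA u
    _ ≤ 2 * besov φ σ h + A * (B * (c * besov φ σ h)) := by
        gcongr
        exact (hB h u p hp hu hw hu1).trans (by gcongr)
    _ = _ := by push_cast; ring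

end Besov

end FourierL2

/-! ### Passage to functions, and the quotient estimate. -/

namespace FourierL2

variable {n : ℕ}

theorem besovNorm_eq (φ : LPCutoff) (σ : ℝ) {f : EuclideanSpace ℝ (Fin n) → ℂ}
    (h : MemLp f 2 volume) : besovNorm φ σ f = besov φ σ (h.toLp f) := dif_pos h

theorem memLp_of_besov {φ : LPCutoff} {σ : ℝ} {f : EuclideanSpace ℝ (Fin n) → ℂ}
    (h : MemBesov φ σ f) : MemLp f 2 volume := by
  by_contra h'
  rw [MemBesov, besovNorm, dif_neg h'] at h
  exact h.ne rfl

theorem besovNorm_congr (φ : LPCutoff) (σ : ℝ) {f g : EuclideanSpace ℝ (Fin n) → ℂ}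
    (h : f =ᵐ[volume] g) : besovNorm φ σ f = besovNorm φ σ g := by
  by_cases hf : MemLp f 2 volume
  · rw [besovNorm_eq φ σ hf, besovNorm_eq φ σ (hf.ae_eq h), MemLp.toLp_congr hf (hf.ae_eq h) h]
  · have hg : ¬ MemLp g 2 volume := fun hg => hf (hg.ae_eq h.symm)
    rw [besovNorm, besovNorm, dif_neg hf, dif_neg hg]

theorem besovNorm_mono (φ : LPCutoff) {σ σ' : ℝ} (h : σ ≤ σ')
    (f : EuclideanSpace ℝ (Fin n) → ℂ) : besovNorm φ σ f ≤ besovNorm φ σ' f := by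
  by_cases hf : MemLp f 2 volume
  · rw [besovNorm_eq φ _ hf, besovNorm_eq φ _ hf]
    exact besov_mono φ h _
  · simp [besovNorm, hf]

theorem besovNorm_add_le (φ : LPCutoff) (σ : ℝ) (f g : EuclideanSpace ℝ (Fin n) → ℂ) :
    besovNorm φ σ (fun x => f x + g x) ≤ besovNorm φ σ f + besovNorm φ σ g := by
  by_cases hf : MemLp f 2 volume
  · by_cases hg : MemLp g 2 volume
    · change besovNorm φ σ (f + g) ≤ _
      rw [besovNorm_eq φ _ hf, besovNorm_eq φ _ hg, besovNorm_eq φ _ (hf.add hg),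
        MemLp.toLp_add]
      exact besov_add_le φ σ _ _
    · simp [besovNorm, hg]
  · simp [besovNorm, hf]

theorem besovNorm_const_mul (φ : LPCutoff) (σ : ℝ) {c : ℂ} (hc : c ≠ 0)
    (f : EuclideanSpace ℝ (Fin n) → ℂ) :
    besovNorm φ σ (fun x => c * f x) ≤ ‖c‖ₑ * besovNorm φ σ f := by
  by_cases hf : MemLp f 2 volume
  · change besovNorm φ σ (c • f) ≤ _
    rw [besovNorm_eq φ _ hf, besovNorm_eq φ _ (hf.const_smul c), MemLp.toLp_const_smul c hf, besov_smul]
  · simp [besovNorm, hf, hc]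

theorem besovNorm_neg_le (φ : LPCutoff) (σ : ℝ) (f : EuclideanSpace ℝ (Fin n) → ℂ) :
    besovNorm φ σ (fun x => -f x) ≤ besovNorm φ σ f := by
  simpa using besovNorm_const_mul φ σ (neg_ne_zero.2 one_ne_zero : (-1 : ℂ) ≠ 0) f

theorem besovNorm_sub_le (φ : LPCutoff) (σ : ℝ) (f g : EuclideanSpace ℝ (Fin n) → ℂ) :
    besovNorm φ σ (fun x => f x - g x) ≤ besovNorm φ σ f + besovNorm φ σ g := by
  simp only [sub_eq_add_neg]
  exact (besovNorm_add_le φ σ f _).trans (by gcongr; exact besovNorm_neg_le φ σ g)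

theorem besovNorm_sub_comm_le (φ : LPCutoff) (σ : ℝ) (f g : EuclideanSpace ℝ (Fin n) → ℂ) :
    besovNorm φ σ (fun x => f x - g x) ≤ besovNorm φ σ (fun x => g x - f x) := by
  simpa using besovNorm_neg_le φ σ (fun x => g x - f x)

theorem besovNorm_zero (φ : LPCutoff) (σ : ℝ) :
    besovNorm φ σ (fun _ : EuclideanSpace ℝ (Fin n) => (0 : ℂ)) = 0 := by
  have h : MemLp (fun _ : EuclideanSpace ℝ (Fin n) => (0 : ℂ)) 2 volume := MemLp.zero
  rw [besovNorm_eq φ σ h]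
  have h0 : h.toLp _ = (0 : ℂ) • h.toLp _ := by
    rw [zero_smul]
    exact MemLp.toLp_zero h
  rw [h0, besov_smul, enorm_zero, zero_mul]

open scoped ComplexConjugate in
theorem besovNorm_conj_le (φ : LPCutoff) (σ : ℝ) (f : EuclideanSpace ℝ (Fin n) → ℂ) :
    besovNorm φ σ (fun x => conj (f x)) ≤ besovNorm φ σ f := by
  by_cases hf : MemLp f 2 volume
  · have hg : MemLp (fun x => conj (f x)) 2 volume := hf.star
    rw [besovNorm_eq φ _ hf, besovNorm_eq φ _ hg]
    refine (besov_conj φ σ ?_).le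
    filter_upwards [hf.coeFn_toLp, hg.coeFn_toLp] with x h1 h2
    rw [h1, h2]
  · simp [besovNorm, hf]

/-- `B^σ_{2,1}` is an algebra for `σ ≥ n / 2`. -/
theorem besovNorm_mul_le (φ : LPCutoff) {σ : ℝ} (hσ0 : 0 < σ) (hσ : (n : ℝ) / 2 ≤ σ) :
    ∃ C : ℝ≥0, ∀ f g : EuclideanSpace ℝ (Fin n) → ℂ, MemBesov φ σ f → MemBesov φ σ g →
      besovNorm φ σ (fun x => f x * g x) ≤ C * (besovNorm φ σ f * besovNorm φ σ g) := by
  obtain ⟨C, hC⟩ := besov_mul_le (n := n) φ hσ0 hσ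
  obtain ⟨W, hW⟩ := wiener_le_besov (n := n) φ hσ
  refine ⟨C, fun f g hf hg => ?_⟩
  have mf := memLp_of_besov hf
  have mg := memLp_of_besov hg
  have hf' : besov φ σ (mf.toLp f) < ∞ := by rwa [MemBesov, besovNorm_eq φ σ mf] at hf
  have hg' : besov φ σ (mg.toLp g) < ∞ := by rwa [MemBesov, besovNorm_eq φ σ mg] at hg
  have hgtop : MemLp g ∞ volume := by
    refine ⟨mg.1, ?_⟩
    rw [← eLpNorm_congr_ae mg.coeFn_toLp]
    exact ((eLpNorm_top_le_wiener _).trans (hW _)).trans_lt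
      (ENNReal.mul_lt_top ENNReal.coe_lt_top hg')
  have mp := memLp_mul mf hgtop
  rw [besovNorm_eq φ σ mf, besovNorm_eq φ σ mg, besovNorm_eq φ σ mp]
  refine hC _ _ _ ?_ hf'.ne hg'.ne
  filter_upwards [mf.coeFn_toLp, mg.coeFn_toLp, mp.coeFn_toLp] with x h1 h2 h3
  rw [h1, h2, h3]

/-- If `h` is small in `B^s_{2,1}`, then `1 / (1 + h) - 1` is controlled by `h` in every
`B^σ_{2,1}`. -/
theorem besovNorm_inverse_le (φ : LPCutoff) {s : ℝ} (hs : (n : ℝ) / 2 ≤ s) :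
    ∃ ε : ℝ≥0, 0 < ε ∧ (∀ h : EuclideanSpace ℝ (Fin n) → ℂ, besovNorm φ s h ≤ ε →
        ∀ᵐ x, 1 + h x ≠ 0) ∧
      ∀ σ, 0 < σ → ∃ C : ℝ≥0, ∀ h : EuclideanSpace ℝ (Fin n) → ℂ,
        besovNorm φ s h ≤ ε → besovNorm φ σ (fun x => -h x / (1 + h x)) ≤ C * besovNorm φ σ h := by
  obtain ⟨W, hW⟩ := wiener_le_besov (n := n) φ hs
  have small (h : EuclideanSpace ℝ (Fin n) → ℂ)
      (hh : besovNorm φ s h ≤ ((2 * (W + 1))⁻¹ : ℝ≥0)) :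
      ∃ m : MemLp h 2 volume, wiener (m.toLp h) ≤ 1 / 2 ∧ ∀ᵐ x, ‖h x‖ ≤ 1 / 2 := by
    have m : MemLp h 2 volume := memLp_of_besov (hh.trans_lt ENNReal.coe_lt_top)
    have hw : wiener (m.toLp h) ≤ 1 / 2 := by
      rw [besovNorm_eq φ s m] at hh
      calc wiener (m.toLp h) ≤ W * ((2 * (W + 1))⁻¹ : ℝ≥0) := (hW _).trans (by gcongr)
        _ = ((W * (2 * (W + 1))⁻¹ : ℝ≥0) : ℝ≥0∞) := by push_cast; rfl
        _ ≤ ((1 / 2 : ℝ≥0) : ℝ≥0∞) := by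
            refine ENNReal.coe_le_coe.2 ?_
            rw [← div_eq_mul_inv, div_le_div_iff₀ (by positivity) (by positivity)]
            rw [one_mul, mul_comm]
            gcongr
            exact le_self_add
        _ = 1 / 2 := by simp
    refine ⟨m, hw, ?_⟩
    have h1 := (eLpNorm_top_le_wiener (m.toLp h)).trans hw
    rw [eLpNorm_congr_ae m.coeFn_toLp, eLpNorm_exponent_top] at h1
    filter_upwards [ae_le_eLpNormEssSup (f := h) (μ := volume)] with x hx
    have h2 := hx.trans h1
    rw [← ofReal_norm, show (1 / 2 : ℝ≥0∞) = ENNReal.ofReal (1 / 2) by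
      rw [ENNReal.ofReal_div_of_pos two_pos]; simp] at h2
    exact (ENNReal.ofReal_le_ofReal_iff (by norm_num)).1 h2
  have low {w : ℂ} (hw : ‖w‖ ≤ 1 / 2) : 1 / 2 ≤ ‖1 + w‖ := by
    have := norm_sub_le (1 + w) w
    simp only [add_sub_cancel_right, norm_one] at this
    linarith
  -- This threshold forces Wiener norm at most `1 / 2`, hence `‖h‖ ≤ 1 / 2` and `‖1 + h‖ ≥ 1 / 2`
  -- almost everywhere; `W + 1` avoids division by zero.
  refine ⟨(2 * (W + 1))⁻¹, by positivity, fun h hh => ?_, fun σ hσ => ?_⟩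
  · obtain ⟨-, -, hx⟩ := small h hh
    filter_upwards [hx] with x hx h0
    have := low hx
    rw [h0, norm_zero] at this
    norm_num at this
  obtain ⟨C, hC⟩ := besov_inverse_le (n := n) φ hσ
  refine ⟨C, fun h hh => ?_⟩
  obtain ⟨m, hw, hx⟩ := small h hh
  have mU : MemLp (fun x => -h x / (1 + h x)) 2 volume := by
    refine m.of_le_mul (c := 2) ?_ ?_
    · exact (m.1.neg.aemeasurable.div (m.1.aemeasurable.const_add 1)).aestronglyMeasurable
    · filter_upwards [hx] with x hx
      have := low hx
      rw [norm_div, norm_neg, div_le_iff₀ (by linarith)]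
      nlinarith [norm_nonneg (h x)]
  rw [besovNorm_eq φ σ m, besovNorm_eq φ σ mU]
  -- For `U = -h / (1 + h)` the product `h U` equals `-(h + U)`, so it lies in `L²` without further
  -- argument.
  refine hC (m.toLp h) (mU.toLp _) (-(m.toLp h + mU.toLp _)) ?_ ?_ hw ?_
  · rw [← MemLp.toLp_add, ← MemLp.toLp_neg]
    filter_upwards [m.coeFn_toLp, mU.coeFn_toLp, (m.add mU).neg.coeFn_toLp, hx] with x h1 h2 h3 h4
    have h0 : 1 + h x ≠ 0 := norm_pos_iff.1 (by linarith [low h4])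
    rw [h1, h2, h3]
    simp only [Pi.neg_apply, Pi.add_apply]
    field_simp
    ring
  · abel
  · rw [eLpNorm_congr_ae mU.coeFn_toLp, eLpNorm_exponent_top]
    refine eLpNormEssSup_le_of_ae_enorm_bound ?_
    filter_upwards [hx] with x hx
    have := low hx
    rw [← ofReal_norm, ← ENNReal.ofReal_one]
    refine ENNReal.ofReal_le_ofReal ?_
    rw [norm_div, norm_neg]
    exact div_le_one_of_le₀ (hx.trans this) (norm_nonneg _)

/-- The constant in the Lipschitz estimate for quotients. -/
noncomputable def quotientBound (K C a a' b : ℝ≥0) : ℝ≥0 :=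
  (1 + K * (C * a)) * (1 + K * (b * (1 + K * (C * a'))))

/-- The map `(z, h) ↦ z / (1 + h)` is locally Lipschitz on `B^σ_{2,1}` as long as `h` is small in
`B^s_{2,1}`. -/
theorem besovNorm_quotient_sub_le (φ : LPCutoff) {s : ℝ} (hs0 : 0 < s) (hs : (n : ℝ) / 2 ≤ s) :
    ∃ ε : ℝ≥0, 0 < ε ∧ ∀ σ, s ≤ σ → ∃ K C : ℝ≥0,
      ∀ (z z' h h' : EuclideanSpace ℝ (Fin n) → ℂ) (a a' b : ℝ≥0) (δ : ℝ≥0∞),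
        besovNorm φ s h ≤ ε → besovNorm φ s h' ≤ ε →
        besovNorm φ σ h ≤ a → besovNorm φ σ h' ≤ a' → besovNorm φ σ z' ≤ b →
        besovNorm φ σ (fun x => z x - z' x) + besovNorm φ σ (fun x => h x - h' x) ≤ δ →
        besovNorm φ σ (fun x => z x / (1 + h x) - z' x / (1 + h' x)) ≤
          quotientBound K C a a' b * δ := by
  obtain ⟨ε, hε, hne, hinv⟩ := besovNorm_inverse_le (n := n) φ hs
  refine ⟨ε, hε, fun σ hσ => ?_⟩
  obtain ⟨K, hK⟩ := besovNorm_mul_le (n := n) φ (hs0.trans_le hσ) (hs.trans hσ)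
  obtain ⟨C, hC⟩ := hinv σ (hs0.trans_le hσ)
  refine ⟨K, C, fun z z' h h' a a' b δ e e' ha ha' hb hδ => ?_⟩
  by_cases hδt : δ = ∞
  · rw [hδt, ENNReal.mul_top]
    · exact le_top
    · exact ENNReal.coe_ne_zero.2 (by simp only [quotientBound]; positivity)
  -- Constants are not in `L²`, so `1 / (1 + h)` enters as `1 + w`. Then `X = (h' - h) / (1 + h)`
  -- and `Y = X / (1 + h')`, and the difference of the quotients is `(z - z') / (1 + h) + z' Y`.
  let w : EuclideanSpace ℝ (Fin n) → ℂ := fun x => -h x / (1 + h x)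
  let w' : EuclideanSpace ℝ (Fin n) → ℂ := fun x => -h' x / (1 + h' x)
  let d : EuclideanSpace ℝ (Fin n) → ℂ := fun x => h' x - h x
  let y : EuclideanSpace ℝ (Fin n) → ℂ := fun x => z x - z' x
  let X : EuclideanSpace ℝ (Fin n) → ℂ := fun x => d x + d x * w x
  let Y : EuclideanSpace ℝ (Fin n) → ℂ := fun x => X x + X x * w' x
  have bw : besovNorm φ σ w ≤ (C * a : ℝ≥0) := by
    push_cast
    exact (hC h e).trans (by gcongr)
  have bw' : besovNorm φ σ w' ≤ (C * a' : ℝ≥0) := by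
    push_cast
    exact (hC h' e').trans (by gcongr)
  have mul_le {f g : EuclideanSpace ℝ (Fin n) → ℂ} {A : ℝ≥0∞} {B : ℝ≥0} (hA : A ≠ ∞)
      (h1 : besovNorm φ σ f ≤ A) (h2 : besovNorm φ σ g ≤ B) :
      besovNorm φ σ (fun x => f x * g x) ≤ A * (K * B : ℝ≥0) := by
    refine (hK f g (h1.trans_lt hA.lt_top) (h2.trans_lt ENNReal.coe_lt_top)).trans ?_
    calc _ ≤ K * (A * B) := by gcongr
      _ = _ := by push_cast; ring
  have one_add_le {f g : EuclideanSpace ℝ (Fin n) → ℂ} {A : ℝ≥0∞} {B : ℝ≥0} (hA : A ≠ ∞)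
      (h1 : besovNorm φ σ f ≤ A) (h2 : besovNorm φ σ g ≤ B) :
      besovNorm φ σ (fun x => f x + f x * g x) ≤ A * (1 + K * B : ℝ≥0) := by
    refine (besovNorm_add_le φ σ f _).trans ?_
    calc _ ≤ A + A * (K * B : ℝ≥0) := add_le_add h1 (mul_le hA h1 h2)
      _ = _ := by push_cast; ring
  let D := besovNorm φ σ fun x => h x - h' x
  let A := besovNorm φ σ fun x => z x - z' x
  have hD : D ≠ ∞ := ne_top_of_le_ne_top hδt (le_add_self.trans hδ)
  have hA : A ≠ ∞ := ne_top_of_le_ne_top hδt (le_self_add.trans hδ)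
  have bX := one_add_le hD (besovNorm_sub_comm_le φ σ h' h) bw
  have bY := one_add_le (f := X) (ENNReal.mul_ne_top hD ENNReal.coe_ne_top) bX bw'
  have bZ := mul_le (ENNReal.mul_ne_top (ENNReal.mul_ne_top hD ENNReal.coe_ne_top)
    ENNReal.coe_ne_top) bY hb
  have by' := one_add_le (f := y) hA le_rfl bw
  have heq : (fun x => z x / (1 + h x) - z' x / (1 + h' x)) =ᵐ[volume]
      fun x => (y x + y x * w x) + Y x * z' x := by
    filter_upwards [hne h e, hne h' e'] with x h1 h2
    simp only [y, Y, X, w, w', d]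
    field_simp
    ring
  rw [besovNorm_congr φ σ heq]
  calc _ ≤ A * (1 + K * (C * a) : ℝ≥0) +
        D * (1 + K * (C * a) : ℝ≥0) * (1 + K * (C * a') : ℝ≥0) * (K * b : ℝ≥0) :=
        (besovNorm_add_le φ σ _ _).trans (add_le_add by' bZ)
    _ ≤ (A + D) * (1 + K * (C * a) : ℝ≥0) +
        (A + D) * (1 + K * (C * a) : ℝ≥0) * (1 + K * (C * a') : ℝ≥0) * (K * b : ℝ≥0) := by
        gcongr
        · exact le_self_add
        · exact le_add_self
    _ = quotientBound K C a a' b * (A + D) := by rw [quotientBound]; push_cast; ring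
    _ ≤ _ := by gcongr

end FourierL2

/-! ### The stereographic projection and its inverse as quotients. -/

namespace FourierL2

variable {n : ℕ}

theorem quotientBound_mono (K C : ℝ≥0) {a₁ a₂ a₁' a₂' b₁ b₂ : ℝ≥0} (ha : a₁ ≤ a₂) (ha' : a₁' ≤ a₂')
    (hb : b₁ ≤ b₂) : quotientBound K C a₁ a₁' b₁ ≤ quotientBound K C a₂ a₂' b₂ := by
  simp only [quotientBound]
  gcongr

section StereographicFormulas

open scoped ComplexConjugate

/-- Real and imaginary parts and `|z|²` are expressed through `z` and `conj z`, so that the algebra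
property and invariance under conjugation suffice. -/
theorem stereoLInv_coord_zero (z : ℂ) :
    (((stereoLInv z).coord 0 : ℝ) : ℂ) = (z + conj z) / (1 + z * conj z) := by
  rw [Complex.add_conj, Complex.mul_conj, ← Complex.sq_norm]
  simp [stereoLInv, Sphere2.coord]

theorem stereoLInv_coord_one (z : ℂ) :
    (((stereoLInv z).coord 1 : ℝ) : ℂ) = (-Complex.I * (z - conj z)) / (1 + z * conj z) := by
  rw [Complex.sub_conj, Complex.mul_conj, ← Complex.sq_norm]
  simp only [stereoLInv, Sphere2.coord]
  push_cast
  rw [show -Complex.I * (2 * z.im * Complex.I) = 2 * z.im by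
    linear_combination (-2 * z.im : ℂ) * Complex.I_mul_I]

theorem stereoLInv_coord_two (z : ℂ) :
    (((stereoLInv z).coord 2 : ℝ) : ℂ) = 1 + (-2 * (z * conj z)) / (1 + z * conj z) := by
  rw [Complex.mul_conj, ← Complex.sq_norm]
  have h : (1 + (‖z‖ : ℂ) ^ 2) ≠ 0 := by
    norm_cast
    positivity
  simp only [stereoLInv, Sphere2.coord]
  simp
  field_simp
  ring

theorem poleQ_coord_zero : poleQ.coord 0 = 0 := by simp [poleQ, Sphere2.coord]

theorem poleQ_coord_one : poleQ.coord 1 = 0 := by simp [poleQ, Sphere2.coord]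

theorem poleQ_coord_two : poleQ.coord 2 = 1 := by simp [poleQ, Sphere2.coord]

theorem stereoLInv_zero : stereoLInv 0 = poleQ := by
  refine Subtype.ext ?_
  simp [stereoLInv, poleQ]

theorem stereoL_poleQ : stereoL poleQ = 0 := by
  simp [stereoL, poleQ_coord_zero, poleQ_coord_one]

/-- Numerator and denominator are halved so that the denominator is `1` plus a quantity vanishing at
`Q`. At `(0, 0, -1)` both denominators are zero and both sides take the value `0`. -/
theorem stereoL_eq_quotient (v : Sphere2) :
    stereoL v = (1 / 2 * (((v.coord 0 - poleQ.coord 0 : ℝ) : ℂ) +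
      Complex.I * ((v.coord 1 - poleQ.coord 1 : ℝ) : ℂ))) /
      (1 + 1 / 2 * ((v.coord 2 - poleQ.coord 2 : ℝ) : ℂ)) := by
  rw [poleQ_coord_zero, poleQ_coord_one, poleQ_coord_two, stereoL]
  push_cast
  rw [show (1 + 1 / 2 * ((v.coord 2 : ℂ) - 1)) = 1 / 2 * (1 + v.coord 2) by ring,
    mul_div_mul_left _ _ (by norm_num)]
  simp

end StereographicFormulas

theorem besovNorm_le_besovDist (φ : LPCutoff) (σ : ℝ) (u v : EuclideanSpace ℝ (Fin n) → Sphere2)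
    (l : Fin 3) : besovNorm φ σ (fun x => (((u x).coord l - (v x).coord l : ℝ) : ℂ)) ≤
      besovDist φ σ u v :=
  Finset.single_le_sum (f := fun l : Fin 3 =>
    besovNorm φ σ fun x => (((u x).coord l - (v x).coord l : ℝ) : ℂ))
    (fun _ _ => zero_le) (Finset.mem_univ l)

theorem memBesovQ_iff (φ : LPCutoff) (σ : ℝ) (u : EuclideanSpace ℝ (Fin n) → Sphere2) :
    MemBesovQ φ σ u ↔ besovQNorm φ σ u < ∞ := by
  rw [besovQNorm, besovDist, ENNReal.sum_lt_top]
  simp [MemBesovQ, MemBesov]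

theorem enorm_half_le : ‖(1 / 2 : ℂ)‖ₑ ≤ 1 := by
  rw [← ofReal_norm, ← ENNReal.ofReal_one]
  exact ENNReal.ofReal_le_ofReal (by norm_num)

theorem besovNorm_half_mul_le (φ : LPCutoff) (σ : ℝ) (f : EuclideanSpace ℝ (Fin n) → ℂ) :
    besovNorm φ σ (fun x => 1 / 2 * f x) ≤ besovNorm φ σ f :=
  (besovNorm_const_mul φ σ (by norm_num) f).trans (mul_le_of_le_one_left' enorm_half_le)

theorem enorm_I : ‖Complex.I‖ₑ = 1 := by
  rw [← ofReal_norm, Complex.norm_I, ENNReal.ofReal_one]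

theorem besovNorm_I_mul_le (φ : LPCutoff) (σ : ℝ) (f : EuclideanSpace ℝ (Fin n) → ℂ) :
    besovNorm φ σ (fun x => Complex.I * f x) ≤ besovNorm φ σ f :=
  (besovNorm_const_mul φ σ Complex.I_ne_zero f).trans_eq (by rw [enorm_I, one_mul])

/-- The stereographic projection is locally Lipschitz from `B^σ_Q` to `B^σ_{2,1}`, near `Q` in
`B^s_Q`. -/
theorem besovNorm_stereoL_sub_le (φ : LPCutoff) {s : ℝ} (hs0 : 0 < s) (hs : (n : ℝ) / 2 ≤ s) :
    ∃ ε : ℝ≥0, 0 < ε ∧ ∀ σ, ∃ F : ℝ≥0 → ℝ≥0 → ℝ≥0,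
      (∀ a a' b b', a ≤ a' → b ≤ b' → F a b ≤ F a' b') ∧
      (s ≤ σ → ∀ u v : EuclideanSpace ℝ (Fin n) → Sphere2,
        besovQNorm φ s u ≤ ε → besovQNorm φ s v ≤ ε → MemBesovQ φ σ u → MemBesovQ φ σ v →
        besovNorm φ σ (fun x => stereoL (u x) - stereoL (v x)) ≤
          F (besovQNorm φ σ u).toNNReal (besovQNorm φ σ v).toNNReal * besovDist φ σ u v) := by
  obtain ⟨ε, hε, hq⟩ := besovNorm_quotient_sub_le (n := n) φ hs0 hs
  refine ⟨ε, hε, fun σ => ?_⟩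
  by_cases hσ : s ≤ σ
  swap
  · exact ⟨fun _ _ => 0, fun _ _ _ _ _ _ => le_rfl, fun h => absurd h hσ⟩
  obtain ⟨K, C, hKC⟩ := hq σ hσ
  refine ⟨fun a b => quotientBound K C a b b,
    fun a a' b b' ha hb => quotientBound_mono K C ha hb hb, fun _ u v eu ev hu hv => ?_⟩
  rw [memBesovQ_iff] at hu hv
  have hh (w : EuclideanSpace ℝ (Fin n) → Sphere2) (τ : ℝ) :
      besovNorm φ τ (fun x => 1 / 2 * (((w x).coord 2 - poleQ.coord 2 : ℝ) : ℂ)) ≤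
        besovQNorm φ τ w :=
    (besovNorm_half_mul_le φ τ _).trans (besovNorm_le_besovDist φ τ w (fun _ => poleQ) 2)
  have hz (w w' : EuclideanSpace ℝ (Fin n) → Sphere2) :
      besovNorm φ σ (fun x => 1 / 2 * ((((w x).coord 0 - (w' x).coord 0 : ℝ) : ℂ) +
        Complex.I * (((w x).coord 1 - (w' x).coord 1 : ℝ) : ℂ))) ≤
      besovNorm φ σ (fun x => (((w x).coord 0 - (w' x).coord 0 : ℝ) : ℂ)) +
      besovNorm φ σ (fun x => (((w x).coord 1 - (w' x).coord 1 : ℝ) : ℂ)) := by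
    refine (besovNorm_half_mul_le φ σ _).trans ((besovNorm_add_le φ σ _ _).trans ?_)
    gcongr
    exact besovNorm_I_mul_le φ σ _
  simp only [stereoL_eq_quotient]
  refine hKC _ _ _ _ _ _ _ _ ((hh u s).trans eu) ((hh v s).trans ev)
    ((hh u σ).trans_eq (ENNReal.coe_toNNReal hu.ne).symm)
    ((hh v σ).trans_eq (ENNReal.coe_toNNReal hv.ne).symm) ?_ ?_
  · rw [ENNReal.coe_toNNReal hv.ne]
    refine (hz v fun _ => poleQ).trans ?_
    rw [besovQNorm, besovDist, Fin.sum_univ_three]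
    exact le_self_add
  · rw [besovDist, Fin.sum_univ_three]
    refine add_le_add ?_ ?_
    · refine le_trans (le_of_eq ?_) (hz u v)
      congr 1
      funext x
      push_cast
      ring
    · refine le_trans (le_of_eq ?_) (besovNorm_half_mul_le φ σ _)
      congr 1
      funext x
      push_cast
      ring

open scoped ComplexConjugate in
/-- The inverse stereographic projection is locally Lipschitz from `B^σ_{2,1}` to `B^σ_Q`, near `0`
in `B^s_{2,1}`. -/
theorem besovDist_stereoLInv_le (φ : LPCutoff) {s : ℝ} (hs0 : 0 < s) (hs : (n : ℝ) / 2 ≤ s) :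
    ∃ ε : ℝ≥0, 0 < ε ∧ ∀ σ, ∃ F : ℝ≥0 → ℝ≥0 → ℝ≥0,
      (∀ a a' b b', a ≤ a' → b ≤ b' → F a b ≤ F a' b') ∧
      (s ≤ σ → ∀ f g : EuclideanSpace ℝ (Fin n) → ℂ,
        besovNorm φ s f ≤ ε → besovNorm φ s g ≤ ε → MemBesov φ σ f → MemBesov φ σ g →
        besovDist φ σ (fun x => stereoLInv (f x)) (fun x => stereoLInv (g x)) ≤
          F (besovNorm φ σ f).toNNReal (besovNorm φ σ g).toNNReal *
            besovNorm φ σ (fun x => f x - g x)) := by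
  obtain ⟨ε, hε, hq⟩ := besovNorm_quotient_sub_le (n := n) φ hs0 hs
  obtain ⟨Ks, hKs⟩ := besovNorm_mul_le (n := n) φ hs0 hs
  -- Makes `|f|²`, whose norm is at most `Ks ε₀²`, meet the threshold `ε` of the quotient estimate.
  let ε₀ : ℝ≥0 := min 1 (ε / (Ks + 1))
  have hε₀ : Ks * (ε₀ * ε₀) ≤ ε := by
    calc Ks * (ε₀ * ε₀) ≤ (Ks + 1) * (1 * (ε / (Ks + 1))) := by
          gcongr
          · exact le_self_add
          · exact min_le_left _ _
          · exact min_le_right _ _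
      _ = ε := by
          rw [one_mul, mul_div_cancel₀]
          positivity
  refine ⟨ε₀, lt_min one_pos (by positivity), fun σ => ?_⟩
  by_cases hσ : s ≤ σ
  swap
  · exact ⟨fun _ _ => 0, fun _ _ _ _ _ _ => le_rfl, fun h => absurd h hσ⟩
  obtain ⟨K, C, hKC⟩ := hq σ hσ
  obtain ⟨A, hA⟩ := besovNorm_mul_le (n := n) φ (hs0.trans_le hσ) (hs.trans hσ)
  -- One common bound for the three coordinates: `2 b + 2 A b²` dominates each numerator built from
  -- `g`. The numerators differ by at most `(2 + 2 A (a + b)) δ` and the denominators by `A (a + b)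
  -- δ`, which add up to the last factor.
  refine ⟨fun a b => 3 * (quotientBound K C (A * (a * a)) (A * (b * b)) (2 * b + 2 * (A * (b * b))) *
    (2 + 3 * (A * (a + b)))), fun a a' b b' ha hb => ?_, fun _ f g ef eg hf hg => ?_⟩
  · have := quotientBound_mono K C (a₁ := A * (a * a)) (a₂ := A * (a' * a'))
      (a₁' := A * (b * b)) (a₂' := A * (b' * b')) (b₁ := 2 * b + 2 * (A * (b * b)))
      (b₂ := 2 * b' + 2 * (A * (b' * b'))) (by gcongr) (by gcongr) (by gcongr)
    beta_reduce
    gcongr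
  set δ := besovNorm φ σ fun x => f x - g x with hδ
  have hdfin : MemBesov φ σ fun x => f x - g x :=
    (besovNorm_sub_le φ σ f g).trans_lt (ENNReal.add_lt_top.2 ⟨hf, hg⟩)
  set a := (besovNorm φ σ f).toNNReal with ha
  set b := (besovNorm φ σ g).toNNReal with hb
  have ha' : besovNorm φ σ f = a := (ENNReal.coe_toNNReal hf.ne).symm
  have hb' : besovNorm φ σ g = b := (ENNReal.coe_toNNReal hg.ne).symm
  have hsq (w : EuclideanSpace ℝ (Fin n) → ℂ) (c : ℝ≥0) (hw : besovNorm φ σ w = c) :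
      besovNorm φ σ (fun x => w x * conj (w x)) ≤ (A * (c * c) : ℝ≥0) := by
    have hw' : MemBesov φ σ w := by rw [MemBesov, hw]; exact ENNReal.coe_lt_top
    refine (hA w _ hw' ((besovNorm_conj_le φ σ w).trans_lt hw')).trans ?_
    push_cast
    gcongr
    · exact hw.le
    · exact (besovNorm_conj_le φ σ w).trans hw.le
  have hsmall (w : EuclideanSpace ℝ (Fin n) → ℂ) (hw : besovNorm φ s w ≤ ε₀) :
      besovNorm φ s (fun x => w x * conj (w x)) ≤ ε := by
    have hw' : MemBesov φ s w := hw.trans_lt ENNReal.coe_lt_top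
    refine (hKs w _ hw' ((besovNorm_conj_le φ s w).trans_lt hw')).trans ?_
    calc _ ≤ (Ks : ℝ≥0∞) * (ε₀ * ε₀) := by
          gcongr
          exact (besovNorm_conj_le φ s w).trans hw
      _ = ((Ks * (ε₀ * ε₀) : ℝ≥0) : ℝ≥0∞) := by push_cast; rfl
      _ ≤ ε := ENNReal.coe_le_coe.2 hε₀
  have hconj : besovNorm φ σ (fun x => conj (f x) - conj (g x)) ≤ δ := by
    simp only [← map_sub]
    exact besovNorm_conj_le φ σ _
  have hsqd : besovNorm φ σ (fun x => f x * conj (f x) - g x * conj (g x)) ≤ A * (a + b) * δ := by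
    have e : (fun x => f x * conj (f x) - g x * conj (g x)) =
        fun x => (f x - g x) * conj (f x) + g x * (conj (f x) - conj (g x)) := by
      funext x
      ring
    rw [e]
    refine (besovNorm_add_le φ σ _ _).trans ?_
    calc _ ≤ A * (δ * a) + A * (b * δ) := by
          refine add_le_add ?_ ?_
          · refine (hA _ _ hdfin ((besovNorm_conj_le φ σ f).trans_lt hf)).trans ?_
            gcongr
            exact (besovNorm_conj_le φ σ f).trans ha'.le
          · refine (hA _ _ hg (hconj.trans_lt hdfin)).trans ?_
            gcongr
            exact hb'.le
      _ = _ := by ring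
  have main (z z' : EuclideanSpace ℝ (Fin n) → ℂ)
      (hz' : besovNorm φ σ z' ≤ (2 * b + 2 * (A * (b * b)) : ℝ≥0))
      (hz : besovNorm φ σ (fun x => z x - z' x) ≤ 2 * δ + 2 * (A * (a + b)) * δ) :
      besovNorm φ σ (fun x => z x / (1 + f x * conj (f x)) - z' x / (1 + g x * conj (g x))) ≤
        quotientBound K C (A * (a * a)) (A * (b * b)) (2 * b + 2 * (A * (b * b))) *
          ((2 + 3 * (A * (a + b)) : ℝ≥0) * δ) := by
    refine hKC _ _ _ _ _ _ _ _ (hsmall f ef) (hsmall g eg) (hsq f a ha') (hsq g b hb') hz' ?_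
    refine (add_le_add hz hsqd).trans_eq ?_
    push_cast
    ring
  have b0 := main (fun x => f x + conj (f x)) (fun x => g x + conj (g x))
    (by
      refine (besovNorm_add_le φ σ _ _).trans ?_
      push_cast
      calc _ ≤ (b : ℝ≥0∞) + b :=
            add_le_add hb'.le ((besovNorm_conj_le φ σ g).trans hb'.le)
        _ = 2 * b := by ring
        _ ≤ _ := le_self_add)
    (by
      have e : (fun x => f x + conj (f x) - (g x + conj (g x))) =
          fun x => (f x - g x) + (conj (f x) - conj (g x)) := by
        funext x
        ring
      rw [e]
      refine (besovNorm_add_le φ σ _ _).trans ((add_le_add le_rfl hconj).trans ?_)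
      rw [← two_mul]
      exact le_self_add)
  have hI (w : EuclideanSpace ℝ (Fin n) → ℂ) :
      besovNorm φ σ (fun x => -Complex.I * w x) ≤ besovNorm φ σ w :=
    (besovNorm_const_mul φ σ (neg_ne_zero.2 Complex.I_ne_zero) w).trans_eq
      (by rw [enorm_neg, enorm_I, one_mul])
  have b1 := main (fun x => -Complex.I * (f x - conj (f x)))
    (fun x => -Complex.I * (g x - conj (g x)))
    (by
      refine (hI _).trans ((besovNorm_sub_le φ σ _ _).trans ?_)
      push_cast
      calc _ ≤ (b : ℝ≥0∞) + b :=
            add_le_add hb'.le ((besovNorm_conj_le φ σ g).trans hb'.le)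
        _ = 2 * b := by ring
        _ ≤ _ := le_self_add)
    (by
      have e : (fun x => -Complex.I * (f x - conj (f x)) - -Complex.I * (g x - conj (g x))) =
          fun x => -Complex.I * ((f x - g x) - (conj (f x) - conj (g x))) := by
        funext x
        ring
      rw [e]
      refine (hI _).trans ((besovNorm_sub_le φ σ _ _).trans ((add_le_add le_rfl hconj).trans ?_))
      rw [← two_mul]
      exact le_self_add)
  have h2 (w : EuclideanSpace ℝ (Fin n) → ℂ) :
      besovNorm φ σ (fun x => -2 * w x) ≤ 2 * besovNorm φ σ w :=
    (besovNorm_const_mul φ σ (by norm_num) w).trans_eq (by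
      rw [enorm_neg, ← ofReal_norm, Complex.norm_two, ENNReal.ofReal_ofNat])
  have b2 := main (fun x => -2 * (f x * conj (f x))) (fun x => -2 * (g x * conj (g x)))
    (by
      refine (h2 _).trans ((mul_le_mul' le_rfl (hsq g b hb')).trans ?_)
      push_cast
      exact le_add_self)
    (by
      simp only [← mul_sub]
      refine (h2 _).trans ((mul_le_mul' le_rfl hsqd).trans ?_)
      rw [mul_assoc 2]
      exact le_add_self)
  rw [besovDist, Fin.sum_univ_three]
  simp only [Complex.ofReal_sub, stereoLInv_coord_zero, stereoLInv_coord_one, stereoLInv_coord_two,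
    add_sub_add_left_eq_sub]
  refine (add_le_add (add_le_add b0 b1) b2).trans_eq ?_
  push_cast
  ring

end FourierL2

/-! ### Assembly of the four assertions. -/

/-- The stereographic projection `L` and its inverse between `B^σ_Q` and `B^σ_{2,1}`, near `Q` in
`B^{σ₀}_Q` and near `0` in `B^{σ₀}_{2,1}`. The constants of the two Lipschitz estimates depend on
the dimension, on `σ` and (monotonically) on the `B^σ` norms only. -/
theorem lemma2p2 (n : ℕ) (hn : 3 ≤ n) (φ : LPCutoff) :
    ∃ C₁ C₂ : ℝ → ℝ → ℝ → ℝ≥0,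
      (∀ σ a a' b b' : ℝ, a ≤ a' → b ≤ b' →
        C₁ σ a b ≤ C₁ σ a' b' ∧ C₂ σ a b ≤ C₂ σ a' b') ∧
      ∀ σ₀ : ℝ, ((n : ℝ) + 1) / 2 ≤ σ₀ →
        ∃ (ε₀ : ℝ) (C : ℝ≥0), 0 < ε₀ ∧
          (∀ f g : EuclideanSpace ℝ (Fin n) → ℂ,
            besovNorm φ σ₀ f ≤ ENNReal.ofReal ε₀ → besovNorm φ σ₀ g ≤ ENNReal.ofReal ε₀ →
            ∀ σ : ℝ, σ₀ ≤ σ → MemBesov φ σ f → MemBesov φ σ g →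
              MemBesovQ φ σ (fun x => stereoLInv (f x)) ∧
              MemBesovQ φ σ (fun x => stereoLInv (g x)) ∧
              besovDist φ σ (fun x => stereoLInv (f x)) (fun x => stereoLInv (g x)) ≤
                C₁ σ (besovNorm φ σ f).toReal (besovNorm φ σ g).toReal *
                  besovNorm φ σ (fun x => f x - g x)) ∧
          (∀ u v : EuclideanSpace ℝ (Fin n) → Sphere2,
            besovQNorm φ σ₀ u ≤ ENNReal.ofReal ε₀ → besovQNorm φ σ₀ v ≤ ENNReal.ofReal ε₀ →
            ∀ σ : ℝ, σ₀ ≤ σ → MemBesovQ φ σ u → MemBesovQ φ σ v →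
              MemBesov φ σ (fun x => stereoL (u x)) ∧
              MemBesov φ σ (fun x => stereoL (v x)) ∧
              besovNorm φ σ (fun x => stereoL (u x) - stereoL (v x)) ≤
                C₂ σ (besovQNorm φ σ u).toReal (besovQNorm φ σ v).toReal *
                  besovDist φ σ u v) ∧
          (∀ ε : ℝ, 0 < ε → ε ≤ ε₀ → ∀ f : EuclideanSpace ℝ (Fin n) → ℂ,
            besovNorm φ σ₀ f ≤ ENNReal.ofReal ε →
              besovQNorm φ σ₀ (fun x => stereoLInv (f x)) ≤ C * ENNReal.ofReal ε) ∧
          (∀ ε : ℝ, 0 < ε → ε ≤ ε₀ → ∀ u : EuclideanSpace ℝ (Fin n) → Sphere2,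
            besovQNorm φ σ₀ u ≤ ENNReal.ofReal ε →
              besovNorm φ σ₀ (fun x => stereoL (u x)) ≤ C * ENNReal.ofReal ε) := by
  have hs0 : 0 < ((n : ℝ) + 1) / 2 := by positivity
  have hs : (n : ℝ) / 2 ≤ ((n : ℝ) + 1) / 2 := by linarith
  obtain ⟨ε₁, hε₁, h₁⟩ := FourierL2.besovDist_stereoLInv_le (n := n) φ hs0 hs
  obtain ⟨ε₂, hε₂, h₂⟩ := FourierL2.besovNorm_stereoL_sub_le (n := n) φ hs0 hs
  choose F₁ mono₁ lip₁ using h₁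
  choose F₂ mono₂ lip₂ using h₂
  -- Smallness is always measured at this lowest exponent, which every `σ₀` dominates; hence `F₁`
  -- and `F₂` do not depend on `σ₀`.
  let s : ℝ := ((n : ℝ) + 1) / 2
  have hQmono {σ σ' : ℝ} (h : σ ≤ σ') (u : EuclideanSpace ℝ (Fin n) → Sphere2) :
      besovQNorm φ σ u ≤ besovQNorm φ σ' u := by
    simp only [besovQNorm, besovDist]
    exact Finset.sum_le_sum fun l _ => FourierL2.besovNorm_mono φ h _
  have zero (τ : ℝ) := FourierL2.besovNorm_zero (n := n) φ τ
  have zeroQ (τ : ℝ) : besovQNorm φ τ (fun _ : EuclideanSpace ℝ (Fin n) => poleQ) = 0 := by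
    simp [besovQNorm, besovDist, zero]
  -- Membership and the linear bounds are the Lipschitz estimates against the constant maps `0` and
  -- `Q`, which correspond to each other.
  have inv₁ (σ : ℝ) (hσ : s ≤ σ) (f : EuclideanSpace ℝ (Fin n) → ℂ)
      (hf : besovNorm φ s f ≤ ε₁) (hm : MemBesov φ σ f) :
      besovQNorm φ σ (fun x => stereoLInv (f x)) ≤
        F₁ σ (besovNorm φ σ f).toNNReal 0 * besovNorm φ σ f := by
    have h := lip₁ σ hσ f (fun _ => 0) hf (by rw [zero]; exact zero_le) hm
      (by rw [MemBesov, zero]; exact ENNReal.zero_lt_top)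
    simpa only [zero, FourierL2.stereoLInv_zero, sub_zero, ENNReal.toNNReal_zero] using! h
  have inv₂ (σ : ℝ) (hσ : s ≤ σ) (u : EuclideanSpace ℝ (Fin n) → Sphere2)
      (hu : besovQNorm φ s u ≤ ε₂) (hm : MemBesovQ φ σ u) :
      besovNorm φ σ (fun x => stereoL (u x)) ≤
        F₂ σ (besovQNorm φ σ u).toNNReal 0 * besovQNorm φ σ u := by
    have h := lip₂ σ hσ u (fun _ => poleQ) hu (by rw [zeroQ]; exact zero_le) hm
      (by rw [FourierL2.memBesovQ_iff, zeroQ]; exact ENNReal.zero_lt_top)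
    simpa only [zeroQ, FourierL2.stereoL_poleQ, sub_zero, ENNReal.toNNReal_zero] using! h
  refine ⟨fun σ a b => F₁ σ a.toNNReal b.toNNReal, fun σ a b => F₂ σ a.toNNReal b.toNNReal,
    fun σ a a' b b' ha hb => ⟨mono₁ _ _ _ _ _ (Real.toNNReal_mono ha) (Real.toNNReal_mono hb),
      mono₂ _ _ _ _ _ (Real.toNNReal_mono ha) (Real.toNNReal_mono hb)⟩, fun σ₀ hσ₀ => ?_⟩
  let ε₀ : ℝ≥0 := min ε₁ ε₂
  have hofReal : ENNReal.ofReal (ε₀ : ℝ) = ε₀ := ENNReal.ofReal_coe_nnreal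
  have le₁ : (ε₀ : ℝ≥0∞) ≤ ε₁ := ENNReal.coe_le_coe.2 (min_le_left _ _)
  have le₂ : (ε₀ : ℝ≥0∞) ≤ ε₂ := ENNReal.coe_le_coe.2 (min_le_right _ _)
  have small {ε : ℝ} (hε : ε ≤ ε₀) : ENNReal.ofReal ε ≤ ε₀ :=
    hofReal ▸ ENNReal.ofReal_le_ofReal hε
  have toNN {x : ℝ≥0∞} (hx : x ≤ ε₀) : x.toNNReal ≤ ε₀ := by
    simpa using ENNReal.toNNReal_mono ENNReal.coe_ne_top hx
  -- Monotonicity bounds the Lipschitz factor on the `ε₀`-ball by its value at `ε₀`, uniformly in `ε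
  -- ≤ ε₀`.
  refine ⟨ε₀, max (F₁ σ₀ ε₀ 0) (F₂ σ₀ ε₀ 0), NNReal.coe_pos.2 (lt_min hε₁ hε₂),
    fun f g hf hg σ hσ mf mg => ?_, fun u v hu hv σ hσ mu mv => ?_, fun ε _ hε f hf => ?_,
    fun ε _ hε u hu => ?_⟩
  · rw [hofReal] at hf hg
    have hf' := (FourierL2.besovNorm_mono φ hσ₀ f).trans (hf.trans le₁)
    have hg' := (FourierL2.besovNorm_mono φ hσ₀ g).trans (hg.trans le₁)
    have hσs : s ≤ σ := le_trans hσ₀ hσ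
    simp only [FourierL2.memBesovQ_iff]
    refine ⟨(inv₁ σ hσs f hf' mf).trans_lt (ENNReal.mul_lt_top ENNReal.coe_lt_top mf),
      (inv₁ σ hσs g hg' mg).trans_lt (ENNReal.mul_lt_top ENNReal.coe_lt_top mg), ?_⟩
    simpa only [ENNReal.toReal, Real.toNNReal_coe] using lip₁ σ hσs f g hf' hg' mf mg
  · rw [hofReal] at hu hv
    have hu' := (hQmono hσ₀ u).trans (hu.trans le₂)
    have hv' := (hQmono hσ₀ v).trans (hv.trans le₂)
    have hσs : s ≤ σ := le_trans hσ₀ hσ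
    have mu' := (FourierL2.memBesovQ_iff φ σ u).1 mu
    have mv' := (FourierL2.memBesovQ_iff φ σ v).1 mv
    refine ⟨(inv₂ σ hσs u hu' mu).trans_lt (ENNReal.mul_lt_top ENNReal.coe_lt_top mu'),
      (inv₂ σ hσs v hv' mv).trans_lt (ENNReal.mul_lt_top ENNReal.coe_lt_top mv'), ?_⟩
    simpa only [ENNReal.toReal, Real.toNNReal_coe] using lip₂ σ hσs u v hu' hv' mu mv
  · have hf0 := hf.trans (small hε)
    refine (inv₁ σ₀ hσ₀ f ((FourierL2.besovNorm_mono φ hσ₀ f).trans (hf0.trans le₁))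
      (hf0.trans_lt ENNReal.coe_lt_top)).trans (mul_le_mul' (ENNReal.coe_le_coe.2 ?_) hf)
    exact (mono₁ _ _ _ _ _ (toNN hf0) le_rfl).trans (le_max_left _ _)
  · have hu0 := hu.trans (small hε)
    refine (inv₂ σ₀ hσ₀ u ((hQmono hσ₀ u).trans (hu0.trans le₂))
      ((FourierL2.memBesovQ_iff φ σ₀ u).2 (hu0.trans_lt ENNReal.coe_lt_top))).trans
      (mul_le_mul' (ENNReal.coe_le_coe.2 ?_) hu)
    exact (mono₂ _ _ _ _ _ (toNN hu0) le_rfl).trans (le_max_right _ _)
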